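/- **Games.** A context-free game is a triple $G=(\Sigma,R,T)$ of a finite alphabet $\Sigma$, a set of rules $R\subseteq\Sigma\times\Sigma^+$ such that each replacement language $L_a=\{v\mid (a,v)\in R\}$ is regular, and a minimal DFA $T=(Q,\Sigma,\delta,s,F)$; $L(T)$ is the target language. Let $\Sigma_f=\{a\in\Sigma\mid L_a\neq\emptyset\}$, let $\{\hat a\mid a\in\Sigma_f\}$ be a disjoint copy of $\Sigma_f$, let $\hat\Sigma=\Sigma\,\dot\cup\,\{\hat a\mid a\in\Sigma_f\}$, and let $\natural:\hat\Sigma^*\to\Sigma^*$ be the homomorphism that deletes the symbols $\hat a$ and is the identity on $\Sigma$. A (one-pass) strategy of Juliet is a map $\sigma:\hat\Sigma^*\times\Sigma_f\to\{\mathrm{Call},\mathrm{Read}\}$; a strategy of Romeo is a map $\tau$ with $\tau(\alpha,a)\in L_a$ for all $(\alpha,a)\in\hat\Sigma^*\times\Sigma_f$. The play of $\sigma$ and $\tau$ on $w\in\Sigma^*$ starts in the configuration $(\epsilon,w)$; from $(\alpha,av)$ with $a\in\Sigma$ it moves to $(\alpha\hat a,\tau(\alpha,a)v)$ if $a\in\Sigma_f$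 and $\sigma(\alpha,a)=\mathrm{Call}$, and to $(\alpha a,v)$ otherwise; it ends when a configuration $(\alpha,\epsilon)$ is reached, and is then won by Juliet if and only if $\natural\alpha\in L(T)$. Infinite plays are not won. A Call of a symbol of the input word has nesting depth $1$, and a Call of a symbol of a word inserted by a Call of nesting depth $d$ has nesting depth $d+1$; the depth of a play is the maximal nesting depth of its Calls ($0$ if there are none). The winning set $W(\sigma)$ is the set of words $w$ such that Juliet wins the play of $\sigma$ and $\tau$ on $w$ for every $\tau$. **Strategies.** $\sigma$ is *dominant* if $W(\sigma')\subseteq W(\sigma)$ for all strategies $\sigma'$, and *undominated* if there is no strategy $\sigma'$ with $W(\sigma)\subsetneq W(\sigma')$. Fix a total order on $\Sigma$ and the induced shortlex order on $\Sigma^*$; for languages $V\ne W$ let $V<_{\mathsf{sl}}W$ if the shortlex-minimal word that is in exactly one of $V,W$ is in $W$. $\sigma$ is *weakly dominant* if $W(\sigma')\le_{\mathsf{sl}}W(\sigma)$ for all strategies $\sigma'$. $\sigma$ is *regular* if $\{\alpha a\mid\sigma(\alpha,a)=\mathrm{Call}\}\subseteq\hat\Sigma^*$ is a regular language. $\sigma$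 is *strongly regular* if $\sigma(\alpha,a)$ depends only on $\natural\alpha$ and $a$, and $\{\natural\alpha\,a\mid\sigma(\alpha,a)=\mathrm{Call}\}$ is the language of a DFA $(Q\cup\{\mathrm{Call}\},\Sigma,\delta',s,\{\mathrm{Call}\})$ with $\delta'(q,a)\in\{\delta(q,a),\mathrm{Call}\}$ for all $q\in Q$, $a\in\Sigma$. **Classes of games.** $G$ has the *bounded depth property* if there are numbers $B_0,B_1,\dots\in\mathbb N$ such that for each strategy $\sigma$ and each $k\in\mathbb N$ there is a strategy $\sigma_k$ such that for each $w\in W(\sigma)$ with $|w|\le k$, $w\in W(\sigma_k)$ and all plays of $\sigma_k$ on $w$ have depth at most $B_{|w|}$. $G$ is *prefix-free* if no $L_a$ contains two words one of which is a proper prefix of the other; *non-recursive* if there are no $n\ge1$ and $a_0,\dots,a_n\in\Sigma_f$ such that $a_0=a_n$ and, for $k=1,\dots,n$, some word of $L_{a_{k-1}}$ contains $a_k$; *unary* if $|\Sigma|=1$. **Theorem.** (a) Every game with the bounded depth property has a weakly dominant strategy. (b) Every prefix-free game has a strategy that is both regular and weakly dominant. (c) Every game with finite target language $L(T)$ that has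 a dominant strategy has a strongly regular dominant strategy. (d) Every non-recursive game that has a dominant strategy has a strongly regular dominant strategy. (e) Every unary game has an undominated strategy. -/

import Mathlib

universe u v

/-- Two automata are compared by the number of states: `T` is minimal if no finite DFA for the same
language has fewer states. -/
def DFA.IsMinimal {A : Type u} {Q : Type v} (T : DFA A Q) : Prop :=
  ∀ (P : Type) [Finite P] (M : DFA A P), M.accepts = T.accepts → Nat.card Q ≤ Nat.card P

/-- A context-free game `(A, R, T)`: a finite alphabet `A`, a set `R` of rules `(a, v)` with `v`
non-empty such that every replacement language `{v | (a, v) ∈ R}` is regular, and a minimal DFA `T`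
with finite state set `Q`. -/
structure Game (A : Type u) (Q : Type v) where
  finite_alphabet : Finite A
  finite_states : Finite Q
  R : Set (A × List A)
  ne_nil : ∀ a v, (a, v) ∈ R → v ≠ []
  regular : ∀ a, Language.IsRegular ({v | (a, v) ∈ R} : Language A)
  T : DFA A Q
  minimal : T.IsMinimal

/-- Juliet's two kinds of moves. -/
inductive Move where
  | read : Move
  | call : Move

namespace Game

variable {A : Type u} {Q : Type v} (G : Game A Q)

/-- The replacement language of `a`. -/
def L (a : A) : Language A := {v | (a, v) ∈ G.R}

/-- `a` is a function symbol: it is the left-hand side of some rule. -/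
def IsFun (a : A) : Prop := ∃ v, (a, v) ∈ G.R

/-- The function symbols. -/
abbrev FunSym : Type u := {a : A // G.IsFun a}

/-- The history alphabet: `Sum.inl a` records that `a` was read, `Sum.inr a` that the function
symbol `a` was called. -/
abbrev Hist : Type u := A ⊕ G.FunSym

variable {G}

/-- The homomorphism that deletes the called symbols from a history string. -/
def natural (α : List G.Hist) : List A := α.filterMap Sum.getLeft?

variable (G)

/-- A configuration: the history string and the remaining string (including the current symbol). -/
abbrev Config : Type u := List G.Hist × List A

/-- A one-pass strategy for Juliet. -/
abbrev Strategy : Type u := List G.Hist → G.FunSym → Move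

/-- A strategy for Romeo. -/
structure Romeo where
  reply : List G.Hist → G.FunSym → List A
  reply_mem : ∀ α a, reply α a ∈ G.L a.1

variable {G}

open Classical in
/-- The symbol that `σ` calls at history string `α` and current symbol `a`, if it plays Call there.
On symbols that are not function symbols, the only possible move is Read. -/
noncomputable def called (σ : G.Strategy) (α : List G.Hist) (a : A) : Option G.FunSym :=
  if h : G.IsFun a then
    match σ α ⟨a, h⟩ with
    | Move.read => none
    | Move.call => some ⟨a, h⟩
  else none

/-- One move. A configuration with empty remaining string is left unchanged. -/
noncomputable def step (σ : G.Strategy) (τ : G.Romeo) : G.Config → G.Config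
  | (α, []) => (α, [])
  | (α, a :: v) =>
    match called σ α a with
    | none => (α ++ [Sum.inl a], v)
    | some b => (α ++ [Sum.inr b], τ.reply α b ++ v)

/-- The play of `σ` and `τ` on the input word `w`, as the sequence of its configurations. A finite
play is continued by repeating its last configuration, the one with empty remaining string. -/
noncomputable def play (σ : G.Strategy) (τ : G.Romeo) (w : List A) : ℕ → G.Config
  | 0 => ([], w)
  | n + 1 => step σ τ (play σ τ w n)

/-- The play of `σ` and `τ` on `w` is winning for Juliet: it is finite and its final string is in
the target language. -/
def PlayWins (σ : G.Strategy) (τ : G.Romeo) (w : List A) : Prop :=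
  ∃ n, (play σ τ w n).2 = [] ∧ natural (play σ τ w n).1 ∈ G.T.accepts

/-- The winning set `W(σ)`: the words on which every play of `σ` is winning for Juliet. -/
def W (σ : G.Strategy) : Language A := {w | ∀ τ : G.Romeo, PlayWins σ τ w}

/-- For each symbol of the remaining string of the `n`th configuration of a play, the number of Call
moves in which it is nested: `0` for the symbols of the input word, and one more than for the called
symbol for the symbols of a replacement word. -/
noncomputable def levels (σ : G.Strategy) (τ : G.Romeo) (w : List A) : ℕ → List ℕ
  | 0 => List.replicate w.length 0
  | n + 1 =>
    match play σ τ w n, levels σ τ w n with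
    | (α, a :: _), l :: ls =>
      match called σ α a with
      | none => ls
      | some b => List.replicate (τ.reply α b).length (l + 1) ++ ls
    | _, ls => ls

/-- The nesting depth of the `n`th move of a play if it is a Call move, and `0` otherwise. -/
noncomputable def callDepth (σ : G.Strategy) (τ : G.Romeo) (w : List A) (n : ℕ) : ℕ :=
  match play σ τ w n, levels σ τ w n with
  | (α, a :: _), l :: _ =>
    match called σ α a with
    | none => 0
    | some _ => l + 1
  | _, _ => 0

/-- The depth of a play: the maximum (supremum) of the nesting depths of its Call moves. -/
noncomputable def depth (σ : G.Strategy) (τ : G.Romeo) (w : List A) : ℕ∞ :=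
  ⨆ n, (callDepth σ τ w n : ℕ∞)

/-- `σ` dominates `σ'`. -/
def Dominates (σ σ' : G.Strategy) : Prop := ∀ w, w ∈ W σ' → w ∈ W σ

/-- `σ` is dominant: it dominates every strategy. -/
def Dominant (σ : G.Strategy) : Prop := ∀ σ' : G.Strategy, Dominates σ σ'

/-- `σ` is undominated: no strategy strictly dominates it. -/
def Undominated (σ : G.Strategy) : Prop :=
  ¬ ∃ σ' : G.Strategy, Dominates σ' σ ∧ W σ ≠ W σ'

end Game

/-- The strict shortlex order on languages: the shortlex-minimal word that belongs to only one of
the two languages exists and belongs to `W`. -/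
def Language.SlLt {A : Type u} [LinearOrder A] (V W : Language A) : Prop :=
  ∃ w, w ∈ W ∧ w ∉ V ∧ ∀ x, List.Shortlex (· < ·) x w → (x ∈ V ↔ x ∈ W)

/-- The shortlex order on languages. -/
def Language.SlLe {A : Type u} [LinearOrder A] (V W : Language A) : Prop :=
  V = W ∨ Language.SlLt V W

namespace Game

variable {A : Type u} {Q : Type v} {G : Game A Q}

/-- `σ` is weakly dominant: its winning set is the greatest one in the shortlex order. -/
def WeaklyDominant [LinearOrder A] (σ : G.Strategy) : Prop :=
  ∀ σ' : G.Strategy, Language.SlLe (W σ') (W σ)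

/-- `σ` is regular: the set of strings `αa` with `σ(α,a) = Call` is regular. -/
def Regular (σ : G.Strategy) : Prop :=
  Language.IsRegular
    ({x | ∃ (α : List G.Hist) (a : G.FunSym), σ α a = Move.call ∧ x = α ++ [Sum.inl a.1]} :
      Language G.Hist)

/-- `σ` is forgetful: its decisions do not depend on the called symbols in the history string. -/
def Forgetful (σ : G.Strategy) : Prop :=
  ∀ (α β : List G.Hist) (a : G.FunSym), natural α = natural β → σ α a = σ β a

/-- `σ` is strongly regular: it is the forgetful strategy of a strategy automaton that results from
the target automaton by adding a state Call (here `none`), which is the only accepting state, and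
redirecting some of the transitions to it. -/
def StronglyRegular (σ : G.Strategy) : Prop :=
  Forgetful σ ∧
  ∃ M : DFA A (Option Q),
    M.start = some G.T.start ∧
    M.accept = {none} ∧
    (∀ q a, M.step (some q) a = some (G.T.step q a) ∨ M.step (some q) a = none) ∧
    M.accepts =
      {x | ∃ (α : List G.Hist) (a : G.FunSym), σ α a = Move.call ∧ x = natural α ++ [a.1]}

variable (G)

/-- The bounded depth property. -/
def BoundedDepth : Prop :=
  ∃ B : ℕ → ℕ, ∀ (σ : G.Strategy) (k : ℕ), ∃ σ' : G.Strategy,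
    ∀ w, w ∈ W σ → w.length ≤ k →
      w ∈ W σ' ∧ ∀ τ : G.Romeo, depth σ' τ w ≤ (B w.length : ℕ∞)

/-- Each replacement language is prefix-free. -/
def PrefixFree : Prop :=
  ∀ a u v, u ∈ G.L a → v ∈ G.L a → u <+: v → u = v

/-- The target language is finite. -/
def FiniteTarget : Prop := Set.Finite {w | w ∈ G.T.accepts}

/-- No symbol can be derived from itself by a non-empty sequence of rules. -/
def NonRecursive : Prop :=
  ¬ ∃ (n : ℕ) (a : ℕ → G.FunSym), 1 ≤ n ∧ a 0 = a n ∧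
    ∀ k < n, ∃ v, v ∈ G.L (a k).1 ∧ (a (k + 1)).1 ∈ v

/-- The alphabet has exactly one symbol. -/
def Unary (_ : Game A Q) : Prop := Nat.card A = 1

end Game

/-!
Everything rests on `Game.mem_W_iff`: a word is in the winning set of `σ` if and only if every
play is finite and ends in an accepting state of the target automaton, which is an inductive
property `Game.Ends` of configurations. For the proof, Romeo's replies are made to depend on the
number of the current move, which the history reveals.

**Weak dominance and bounded depth.** Any family of sets of words has a supremum for the order by
the first difference that is approximated by members of the family on initial segments
(`FirstDiffLE.exists_greedy`). For the family of the winning sets, the approximating strategies may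
be taken of bounded depth; a limit of them along an ultrafilter has the same bounds on the depth,
so its plays are finite, and they agree with plays of the approximating strategies.

**Prefix-free games.** Call a set `S` of states enforceable for a symbol in a state `p` if Juliet
can process the symbol such that she ends in `S`; she does so by reading, or by calling and then
maintaining an invariant on pairs of a state and a residual language of the reply. There are
finitely many states, symbols and sets of states, so some nesting depth `N` suffices for all of them
(`Game.exists_handle_depth`), and in every winning play the sets of reachable states are enforceable
(`Game.Ends.handle`). Therefore every winning set is contained in the language of a run that labels the prefixes of the input word
with sets of states, each of which is enforceable from the one before. Among such runs there is an
optimal one that is given by a choice function on labels (`exists_optimal_policy`). If the game is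
prefix-free, then Juliet knows when a reply has ended, so she can play according to this run with a
stack of at most `N` frames as her memory, which is finite.

**Strongly regular dominant strategies.** If there is a dominant strategy, then Juliet can stay
within winning configurations in states from which there is a dominant strategy: she reads whenever
this is safe and calls otherwise, and calling is then safe (`Game.exists_called_of_not_readSafe`).
This strategy depends on the state and the symbol only. It is dominant if its plays are finite. In a
non-recursive game they are, as every call replaces a symbol by smaller ones. If the target language
is finite, then the lengths of the final strings are bounded, so an infinite play would eventually
consist of calls with replies of length one; but a dominant strategy has to read one of the
symbols that recur, and then reading it is safe (`Game.exists_readSafe_of_unit_replies`).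

**Unary games.** The history does not reveal Romeo's replies, so a strategy is a sequence of moves,
and acceptance is eventually periodic with some period `c`. If the lengths of two replies differ
by at least `c`, then strategies that win whenever reading everything does can differ
from it on short words only. If there is a reply of length one, then reading everything is dominant.
Otherwise there are finitely many replies, all of length at least two. Then limits of strategies
that approximate the greedy supremum `V` work, provided each approximation makes its longest play as
short as possible. For if Romeo had an infinite play against the limit on a length in `V`, then he
could play it such that the number of remaining symbols returns to the same value again and again,
or such that it rises while he gives shortest replies; in both cases an approximation could be
shortened by deleting or rearranging a block of moves (`UnaryGame.Reduced.not_return`,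
`UnaryGame.Reduced.not_rise`).
-/

/-! ### Comparing sets at the first difference -/

/-- The order on sets that compares them at the element of least rank on which they differ, where
`f` assigns ranks: `V ≤ W` if that element, when there is one, belongs to `W`. -/
def FirstDiffLE {α : Type*} (f : α → ℕ) (V W : Set α) : Prop :=
  ∀ w ∈ V, (∀ x, f x < f w → (x ∈ V ↔ x ∈ W)) → w ∈ W

namespace FirstDiffLE

variable {α : Type*} {f : α → ℕ} {U V W : Set α}

theorem exists_first_diff (f : α → ℕ) (h : V ≠ W) :
    ∃ w, ¬ (w ∈ V ↔ w ∈ W) ∧ ∀ x, f x < f w → (x ∈ V ↔ x ∈ W) := by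
  obtain ⟨z, hz⟩ : ∃ z, ¬ (z ∈ V ↔ z ∈ W) := by
    by_contra! hc
    exact h (Set.ext hc)
  obtain ⟨w, hw, hmin⟩ := (measure f).wf.has_min {z | ¬ (z ∈ V ↔ z ∈ W)} ⟨z, hz⟩
  refine ⟨w, hw, fun x hx => ?_⟩
  by_contra hc
  exact hmin x hc hx

theorem of_subset (h : V ⊆ W) : FirstDiffLE f V W := fun _ hw _ => h hw

theorem refl (V : Set α) : FirstDiffLE f V V := of_subset le_rfl

theorem eq_of_superset (h : FirstDiffLE f V W) (hWV : W ⊆ V) : V = W := by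
  by_contra hne
  obtain ⟨w, hw, hlt⟩ := exists_first_diff f hne
  by_cases hwV : w ∈ V
  · exact hw ⟨fun _ => h w hwV hlt, fun _ => hwV⟩
  · exact hw ⟨fun h' => absurd h' hwV, fun h' => hWV h'⟩

theorem antisymm (h : FirstDiffLE f V W) (h' : FirstDiffLE f W V) : V = W := by
  by_contra hne
  obtain ⟨w, hw, hlt⟩ := exists_first_diff f hne
  exact hw ⟨fun hV => h w hV hlt, fun hW => h' w hW fun x hx => (hlt x hx).symm⟩

theorem trans (h : FirstDiffLE f U V) (h' : FirstDiffLE f V W) : FirstDiffLE f U W := by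
  intro w hw hlt
  by_cases hUV : ∀ x, f x < f w → (x ∈ U ↔ x ∈ V)
  · exact h' w (h w hw hUV) fun x hx => (hUV x hx).symm.trans (hlt x hx)
  · push Not at hUV
    obtain ⟨z, hz, hmin⟩ := (measure f).wf.has_min {x | f x < f w ∧ ¬ (x ∈ U ↔ x ∈ V)} (by
      obtain ⟨x, hx, hx'⟩ := hUV
      exact ⟨x, hx, by tauto⟩)
    have hUVz : ∀ x, f x < f z → (x ∈ U ↔ x ∈ V) := fun x hx => by
      by_contra hc
      exact hmin x ⟨hx.trans hz.1, hc⟩ hx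
    exfalso
    apply hz.2
    refine ⟨fun hU => h z hU hUVz, fun hV => ?_⟩
    exact (hlt z hz.1).2 (h' z hV fun x hx => (hUVz x hx).symm.trans (hlt x (hx.trans hz.1)))

theorem total (hf : Function.Injective f) (V W : Set α) :
    FirstDiffLE f V W ∨ FirstDiffLE f W V := by
  by_cases hne : V = W
  · exact Or.inl (hne ▸ refl _)
  obtain ⟨w, hw, hlt⟩ := exists_first_diff f hne
  have key : ∀ X Y : Set α, w ∈ X → w ∉ Y → (∀ x, f x < f w → (x ∈ X ↔ x ∈ Y)) →
      FirstDiffLE f Y X := by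
    intro X Y hX hY hXY z hz hzlt
    rcases lt_trichotomy (f z) (f w) with h | h | h
    · exact (hXY z h).2 hz
    · exact absurd (hf h ▸ hz) hY
    · exact absurd ((hzlt w h).2 hX) hY
  by_cases hV : w ∈ V
  · exact Or.inr (key V W hV (fun hW => hw ⟨fun _ => hW, fun _ => hV⟩) hlt)
  · refine Or.inl (key W V (by tauto) hV fun x hx => (hlt x hx).symm)

/-- A non-empty family of sets has a supremum that is approximated by its members: including
elements greedily in the order of their ranks yields a set that is an upper bound, and that agrees
with a member of the family on any initial segment. -/
theorem exists_greedy (hf : Function.Injective f) (F : Set (Set α)) (hF : F.Nonempty) :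
    ∃ V : Set α, (∀ W ∈ F, FirstDiffLE f W V) ∧
      ∀ n, ∃ W ∈ F, ∀ x, f x < n → (x ∈ W ↔ x ∈ V) := by
  let P : α → Prop := (measure f).wf.fix (C := fun _ => Prop) fun w ih =>
    ∃ W ∈ F, w ∈ W ∧ ∀ x (h : f x < f w), x ∈ W ↔ ih x h
  have hP : ∀ w, P w ↔ ∃ W ∈ F, w ∈ W ∧ ∀ x, f x < f w → (x ∈ W ↔ P x) := by
    intro w
    have := (measure f).wf.fix_eq (C := fun _ => Prop) (fun w ih =>
      ∃ W ∈ F, w ∈ W ∧ ∀ x (h : f x < f w), x ∈ W ↔ ih x h) w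
    exact iff_of_eq this
  refine ⟨{w | P w}, fun W hW w hw hlt => (hP w).2 ⟨W, hW, hw, hlt⟩, fun n => ?_⟩
  induction n with
  | zero => exact hF.imp fun W hW => ⟨hW, fun x hx => absurd hx (Nat.not_lt_zero _)⟩
  | succ n ih =>
    by_cases h : ∃ w, f w = n ∧ P w
    · obtain ⟨w, rfl, hw⟩ := h
      obtain ⟨W, hW, hwW, hlt⟩ := (hP w).1 hw
      refine ⟨W, hW, fun x hx => ?_⟩
      rcases Nat.lt_succ_iff_lt_or_eq.1 hx with hx | hx
      · exact hlt x hx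
      · rw [hf hx]
        exact ⟨fun _ => hw, fun _ => hwW⟩
    · push Not at h
      obtain ⟨W, hW, hlt⟩ := ih
      refine ⟨W, hW, fun x hx => ?_⟩
      rcases Nat.lt_succ_iff_lt_or_eq.1 hx with hx | hx
      · exact hlt x hx
      · refine ⟨fun hxW => (hP x).2 ⟨W, hW, hxW, fun y hy => hlt y (hx ▸ hy)⟩, fun hxP => ?_⟩
        exact absurd hxP (h x hx)

end FirstDiffLE

/-- The rank of a word in the shortlex order: the number of smaller words. -/
noncomputable def shortlexRank {A : Type u} [LinearOrder A] (w : List A) : ℕ :=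
  {x : List A | List.Shortlex (· < ·) x w}.ncard

section Shortlex

variable {A : Type u} [LinearOrder A]

theorem List.Shortlex.trans' {x y z : List A} (h : List.Shortlex (· < ·) x y)
    (h' : List.Shortlex (· < ·) y z) : List.Shortlex (· < ·) x z := by
  rw [List.shortlex_def] at *
  rcases h with h | ⟨h1, h2⟩ <;> rcases h' with h' | ⟨h1', h2'⟩
  · left; omega
  · left; omega
  · left; omega
  · right
    exact ⟨h1.trans h1', List.lt_trans (α := A) h2 h2'⟩

theorem shortlexRank_lt_iff [Finite A] {x y : List A} :
    shortlexRank x < shortlexRank y ↔ List.Shortlex (· < ·) x y := by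
  have key : ∀ {x y : List A}, List.Shortlex (· < ·) x y → shortlexRank x < shortlexRank y := by
    intro x y h
    refine Set.ncard_lt_ncard (Set.ssubset_iff_of_subset (fun z hz => hz.trans' h) |>.2
      ⟨x, h, fun hx => ?_⟩) ((List.finite_length_le A y.length).subset fun z hz => ?_)
    · exact Std.Asymm.asymm _ _ hx hx
    · rcases List.shortlex_def.1 hz with h | h
      · exact h.le
      · exact h.1.le
  refine ⟨fun h => ?_, key⟩
  by_contra hc
  by_cases hyx : List.Shortlex (· < ·) y x
  · exact absurd (key hyx) (by omega)
  · rw [Std.Trichotomous.trichotomous (r := List.Shortlex (· < ·)) x y hc hyx] at h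
    exact lt_irrefl _ h

theorem shortlexRank_injective [Finite A] :
    Function.Injective (shortlexRank : List A → ℕ) := by
  intro x y h
  refine Std.Trichotomous.trichotomous (r := List.Shortlex (· < ·)) x y ?_ ?_ <;>
    rw [← shortlexRank_lt_iff] <;> omega

theorem Language.slLe_iff_firstDiffLE [Finite A] {V W : Language A} :
    Language.SlLe V W ↔ FirstDiffLE shortlexRank (V : Set (List A)) W := by
  constructor
  · rintro (rfl | ⟨w, hW, hV, hlt⟩)
    · exact FirstDiffLE.refl _
    · intro z hz hzlt
      rcases lt_trichotomy (shortlexRank z) (shortlexRank w) with h | h | h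
      · exact (hlt z (shortlexRank_lt_iff.1 h)).1 hz
      · exact absurd (shortlexRank_injective h ▸ hz) hV
      · exact absurd ((hzlt w h).2 hW) hV
  · intro h
    by_cases hne : V = W
    · exact Or.inl hne
    obtain ⟨w, hw, hlt⟩ := FirstDiffLE.exists_first_diff shortlexRank (V := V) (W := W) hne
    have hV : w ∉ V := fun hV => hw ⟨fun _ => h w hV hlt, fun _ => hV⟩
    have hW : w ∈ W := by
      by_contra hW
      exact hw ⟨fun h' => absurd h' hV, fun h' => absurd h' hW⟩
    exact Or.inr ⟨w, hW, hV, fun x hx => hlt x (shortlexRank_lt_iff.2 hx)⟩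

end Shortlex

/-! ### Termination of list rewriting -/

/-- Rewriting the head of a list: it is deleted, or replaced by a list of smaller elements. -/
def HeadRewrite {α : Type*} (r : α → α → Prop) (l' l : List α) : Prop :=
  ∃ a v x, l = a :: v ∧ l' = x ++ v ∧ ∀ b ∈ x, r b a

theorem HeadRewrite.wellFounded {α : Type*} {r : α → α → Prop} (h : WellFounded r) :
    WellFounded (HeadRewrite r) := by
  have cons : ∀ a : α, ∀ v, Acc (HeadRewrite r) v → Acc (HeadRewrite r) (a :: v) := by
    intro a
    induction a using h.induction with
    | _ a ih =>
      intro v hv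
      refine Acc.intro _ ?_
      rintro _ ⟨a', v', x, heq, rfl, hx⟩
      obtain ⟨rfl, rfl⟩ := List.cons.inj heq
      clear heq
      induction x with
      | nil => exact hv
      | cons b x ihx =>
        exact ih b (hx b (by simp)) _ (ihx fun c hc => hx c (by simp [hc]))
  refine ⟨fun l => ?_⟩
  induction l with
  | nil =>
    refine Acc.intro _ ?_
    rintro _ ⟨a', v', x, heq, -⟩
    cases heq
  | cons a l ih => exact cons a l ih

/-! ### Limits along an ultrafilter -/

/-- A sequence in a finite type is constant on a set of the ultrafilter. -/
theorem Ultrafilter.exists_eventually_eq {X : Type*} [Finite X] (U : Ultrafilter ℕ) (g : ℕ → X) :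
    ∃ x, ∀ᶠ k in (U : Filter ℕ), g k = x := by
  obtain ⟨x, hx⟩ := Ultrafilter.eq_pure_of_finite (U.map g)
  refine ⟨x, ?_⟩
  have : {x} ∈ U.map g := by rw [hx]; exact Ultrafilter.mem_pure.2 rfl
  exact this

namespace Game

variable {A : Type u} {Q : Type v} {G : Game A Q}

/-! ### Winning as a well-founded tree of plays -/

theorem called_eq_some {σ : G.Strategy} {α : List G.Hist} {a : A} {b : G.FunSym} :
    called σ α a = some b ↔ b.1 = a ∧ σ α b = Move.call := by
  unfold called
  split_ifs with h
  · cases hm : σ α ⟨a, h⟩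
    · simp only [reduceCtorEq, false_iff, not_and]
      rintro rfl hb
      rw [hm] at hb
      cases hb
    · simp only [Option.some.injEq]
      constructor
      · rintro rfl
        exact ⟨rfl, hm⟩
      · rintro ⟨rfl, -⟩
        rfl
  · simp only [false_iff, not_and]
    rintro rfl
    exact absurd b.2 h

theorem called_eq_none {σ : G.Strategy} {α : List G.Hist} {a : A} :
    called σ α a = none ↔ ∀ h : G.IsFun a, σ α ⟨a, h⟩ = Move.read := by
  rw [Option.eq_none_iff_forall_ne_some]
  constructor
  · intro hn h
    have := hn ⟨a, h⟩
    rw [Ne, called_eq_some] at this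
    cases hm : σ α ⟨a, h⟩
    · rfl
    · exact absurd ⟨rfl, hm⟩ this
  · intro hn b hb
    obtain ⟨rfl, hb'⟩ := called_eq_some.1 hb
    have := hn b.2
    rw [hb'] at this
    cases this

/-- `Ends σ S α q w`: when `σ` continues from the history `α` with the target automaton in state `q`
and the remaining string `w`, every play is finite and ends with the target automaton in a state
of `S`. -/
inductive Ends (σ : G.Strategy) (S : Set Q) : List G.Hist → Q → List A → Prop
  | nil {α : List G.Hist} {q : Q} : q ∈ S → Ends σ S α q []
  | read {α : List G.Hist} {q : Q} {a : A} {v : List A} : called σ α a = none →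
      Ends σ S (α ++ [Sum.inl a]) (G.T.step q a) v → Ends σ S α q (a :: v)
  | call {α : List G.Hist} {q : Q} {a : A} {v : List A} {b : G.FunSym} : called σ α a = some b →
      (∀ x ∈ G.L b.1, Ends σ S (α ++ [Sum.inr b]) q (x ++ v)) → Ends σ S α q (a :: v)

theorem natural_append_inl (α : List G.Hist) (a : A) :
    natural (α ++ [Sum.inl a]) = natural α ++ [a] := by
  simp [natural]

theorem natural_append_inr (α : List G.Hist) (b : G.FunSym) :
    natural (α ++ [Sum.inr b]) = natural α := by
  simp [natural]

/-- The state of the target automaton after the history `α`. -/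
def state (α : List G.Hist) : Q := G.T.eval (natural α)

theorem state_append_inl (α : List G.Hist) (a : A) :
    state (α ++ [Sum.inl a]) = G.T.step (state α) a := by
  simp [state, natural_append_inl]

theorem state_append_inr (α : List G.Hist) (b : G.FunSym) :
    state (α ++ [Sum.inr b]) = state α := by
  simp [state, natural_append_inr]

theorem Ends.nil_iff {σ : G.Strategy} {S : Set Q} {α : List G.Hist} {q : Q} :
    Ends σ S α q [] ↔ q ∈ S :=
  ⟨fun h => by cases h; assumption, Ends.nil⟩

theorem Ends.read_iff {σ : G.Strategy} {S : Set Q} {α : List G.Hist} {q : Q} {a : A} {v : List A}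
    (h : called σ α a = none) :
    Ends σ S α q (a :: v) ↔ Ends σ S (α ++ [Sum.inl a]) (G.T.step q a) v := by
  refine ⟨fun he => ?_, Ends.read h⟩
  cases he with
  | read _ he => exact he
  | call h' => rw [h] at h'; cases h'

theorem Ends.call_iff {σ : G.Strategy} {S : Set Q} {α : List G.Hist} {q : Q} {a : A} {v : List A}
    {b : G.FunSym} (h : called σ α a = some b) :
    Ends σ S α q (a :: v) ↔ ∀ x ∈ G.L b.1, Ends σ S (α ++ [Sum.inr b]) q (x ++ v) := by
  refine ⟨fun he => ?_, Ends.call h⟩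
  cases he with
  | read h' _ => rw [h] at h'; cases h'
  | call h' he =>
    rw [h] at h'
    cases h'
    exact he

theorem Ends.playWins {σ : G.Strategy} {α : List G.Hist} {q : Q} {v : List A}
    (h : Ends σ G.T.accept α q v) (τ : G.Romeo) (w : List A) (n : ℕ)
    (hn : play σ τ w n = (α, v)) (hq : q = state α) : PlayWins σ τ w := by
  induction h generalizing n with
  | nil hq' =>
    subst hq
    exact ⟨n, by rw [hn], by rw [hn]; exact hq'⟩
  | read hc _ ih =>
    refine ih (n + 1) ?_ ?_
    · simp [play, hn, step, hc]
    · rw [hq, state_append_inl]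
  | @call α q a v b hc _ ih =>
    refine ih (τ.reply α b) (τ.reply_mem α b) (n + 1) ?_ ?_
    · simp [play, hn, step, hc]
    · rw [hq, state_append_inr]

open Classical in
/-- A reply of Romeo to a call of `b` at the configuration `c` that keeps the play from being won,
if there is one. -/
noncomputable def spoil (σ : G.Strategy) (c : G.Config) (b : G.FunSym) : List A :=
  if h : ∃ x ∈ G.L b.1, ¬ Ends σ G.T.accept (c.1 ++ [Sum.inr b]) (state c.1) (x ++ c.2.tail) then
    h.choose
  else b.2.choose

theorem spoil_mem (σ : G.Strategy) (c : G.Config) (b : G.FunSym) : spoil σ c b ∈ G.L b.1 := by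
  unfold spoil
  split_ifs with h
  · exact h.choose_spec.1
  · exact b.2.choose_spec

theorem spoil_spec (σ : G.Strategy) (c : G.Config) (b : G.FunSym)
    (h : ∃ x ∈ G.L b.1, ¬ Ends σ G.T.accept (c.1 ++ [Sum.inr b]) (state c.1) (x ++ c.2.tail)) :
    ¬ Ends σ G.T.accept (c.1 ++ [Sum.inr b]) (state c.1) (spoil σ c b ++ c.2.tail) := by
  unfold spoil
  rw [dif_pos h]
  exact h.choose_spec.2

/-- The strategy of Romeo that replies at every history as `spoil` does at `c`. -/
noncomputable def spoiler (σ : G.Strategy) (c : G.Config) : G.Romeo :=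
  ⟨fun _ => spoil σ c, fun _ => spoil_mem σ c⟩

/-- The play in which Romeo's replies may depend on the whole configuration, and spoil it. -/
noncomputable def spoiledPlay (σ : G.Strategy) (w : List A) : ℕ → G.Config
  | 0 => ([], w)
  | n + 1 => step σ (spoiler σ (spoiledPlay σ w n)) (spoiledPlay σ w n)

theorem spoiledPlay_length (σ : G.Strategy) (w : List A) (n : ℕ)
    (h : (spoiledPlay σ w n).2 ≠ []) : (spoiledPlay σ w n).1.length = n := by
  induction n with
  | zero => rfl
  | succ n ih =>
    rw [spoiledPlay] at h ⊢
    obtain ⟨⟨α, r⟩, hc⟩ : ∃ c, spoiledPlay σ w n = c := ⟨_, rfl⟩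
    rw [hc] at h ih ⊢
    cases r with
    | nil => exact absurd rfl h
    | cons a v =>
      have := ih (by simp)
      simp only at this
      simp only [step]
      split <;> simp [this]

/-- The winning set is the set of words on which every play is finite and ends in an accepting
state. For the forward direction, a spoiled play is a play against a genuine strategy of Romeo,
because the history determines the number of the current move. -/
theorem mem_W_iff {σ : G.Strategy} {w : List A} :
    w ∈ W σ ↔ Ends σ G.T.accept [] G.T.start w := by
  refine ⟨fun h => ?_, fun h τ => h.playWins τ w 0 rfl rfl⟩
  by_contra hbad
  let τ : G.Romeo := ⟨fun α => spoil σ (spoiledPlay σ w α.length), fun _ => spoil_mem σ _⟩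
  have hplay : ∀ n, play σ τ w n = spoiledPlay σ w n := by
    intro n
    induction n with
    | zero => rfl
    | succ n ih =>
      rw [play, ih, spoiledPlay]
      have hlen := spoiledPlay_length σ w n
      obtain ⟨⟨α, r⟩, hc⟩ : ∃ c, spoiledPlay σ w n = c := ⟨_, rfl⟩
      rw [hc] at hlen ⊢
      cases r with
      | nil => rfl
      | cons a v =>
        have hα : α.length = n := hlen (by simp)
        simp only [step, τ, spoiler, hα, hc]
  have hnot : ∀ n, ¬ Ends σ G.T.accept (spoiledPlay σ w n).1 (state (spoiledPlay σ w n).1)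
      (spoiledPlay σ w n).2 := by
    intro n
    induction n with
    | zero => exact hbad
    | succ n ih =>
      rw [spoiledPlay]
      obtain ⟨⟨α, r⟩, hc⟩ : ∃ c, spoiledPlay σ w n = c := ⟨_, rfl⟩
      rw [hc] at ih ⊢
      cases r with
      | nil => exact ih
      | cons a v =>
        simp only [step]
        split
        · next hca =>
          rw [Ends.read_iff hca] at ih
          rwa [state_append_inl]
        · next b hca =>
          rw [Ends.call_iff hca] at ih
          push Not at ih
          rw [state_append_inr]
          exact spoil_spec σ (α, a :: v) b ih
  obtain ⟨n, hn, hacc⟩ := h τ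
  rw [hplay] at hn hacc
  apply hnot n
  rw [hn]
  exact Ends.nil hacc

/-- The strategy that continues `σ` after the history `α`. -/
def residual (σ : G.Strategy) (α : List G.Hist) : G.Strategy := fun β => σ (α ++ β)

theorem ends_residual {σ : G.Strategy} {S : Set Q} {α β : List G.Hist} {q : Q} {w : List A} :
    Ends (residual σ α) S β q w ↔ Ends σ S (α ++ β) q w := by
  constructor
  · intro h
    induction h with
    | nil hq => exact Ends.nil hq
    | read hc _ ih => exact Ends.read hc (by simpa [List.append_assoc] using ih)
    | call hc _ ih => exact Ends.call hc fun x hx => by simpa [List.append_assoc] using ih x hx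
  · generalize hγ : α ++ β = γ
    intro h
    induction h generalizing β with
    | nil hq => exact Ends.nil hq
    | read hc _ ih =>
      subst hγ
      exact Ends.read hc (ih (by simp))
    | call hc _ ih =>
      subst hγ
      exact Ends.call hc fun x hx => ih x hx (by simp)

/-- A property of configurations that is preserved by the moves of `σ`, whatever the replies,
and holds of finished configurations in `S` only, gives `Ends` when there are no infinite plays
within it. -/
theorem Ends.of_invariant {σ : G.Strategy} {S : Set Q} (I : List G.Hist → Q → List A → Prop)
    (hnil : ∀ α q, I α q [] → q ∈ S)
    (hread : ∀ α q a v, I α q (a :: v) → called σ α a = none →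
      I (α ++ [Sum.inl a]) (G.T.step q a) v)
    (hcall : ∀ α q a v b, I α q (a :: v) → called σ α a = some b → ∀ x ∈ G.L b.1,
      I (α ++ [Sum.inr b]) q (x ++ v))
    (hfin : ¬ ∃ c : ℕ → List G.Hist × Q × List A, (∀ n, I (c n).1 (c n).2.1 (c n).2.2) ∧
      ∀ n, (∃ a v, c n = ((c n).1, (c n).2.1, a :: v) ∧ called σ (c n).1 a = none ∧
          c (n + 1) = ((c n).1 ++ [Sum.inl a], G.T.step (c n).2.1 a, v)) ∨
        (∃ a v b x, c n = ((c n).1, (c n).2.1, a :: v) ∧ called σ (c n).1 a = some b ∧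
          x ∈ G.L b.1 ∧ c (n + 1) = ((c n).1 ++ [Sum.inr b], (c n).2.1, x ++ v)))
    {α : List G.Hist} {q : Q} {w : List A} (h : I α q w) : Ends σ S α q w := by
  by_contra hbad
  apply hfin
  let X := {c : List G.Hist × Q × List A // I c.1 c.2.1 c.2.2 ∧ ¬ Ends σ S c.1 c.2.1 c.2.2}
  have hstep : ∀ c : X, ∃ c' : X,
      (∃ a v, c.1 = (c.1.1, c.1.2.1, a :: v) ∧ called σ c.1.1 a = none ∧
          c'.1 = (c.1.1 ++ [Sum.inl a], G.T.step c.1.2.1 a, v)) ∨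
        (∃ a v b x, c.1 = (c.1.1, c.1.2.1, a :: v) ∧ called σ c.1.1 a = some b ∧
          x ∈ G.L b.1 ∧ c'.1 = (c.1.1 ++ [Sum.inr b], c.1.2.1, x ++ v)) := by
    rintro ⟨⟨α, q, w⟩, hI, hE⟩
    cases w with
    | nil => exact absurd (Ends.nil (hnil _ _ hI)) hE
    | cons a v =>
      rcases hc : called σ α a with _ | b
      · simp only [Ends.read_iff hc] at hE
        exact ⟨⟨_, hread _ _ _ _ hI hc, hE⟩, Or.inl ⟨a, v, rfl, hc, rfl⟩⟩
      · simp only [Ends.call_iff hc] at hE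
        push Not at hE
        obtain ⟨x, hx, hE⟩ := hE
        exact ⟨⟨(_, _, _), hcall _ _ _ _ _ hI hc x hx, hE⟩, Or.inr ⟨a, v, b, x, rfl, hc, hx, rfl⟩⟩
  choose next hnext using hstep
  let c : ℕ → X := fun n => next^[n] ⟨(α, q, w), h, hbad⟩
  refine ⟨fun n => (c n).1, fun n => (c n).2.1, fun n => ?_⟩
  have : c (n + 1) = next (c n) := Function.iterate_succ_apply' _ _ _
  simp only [this]
  exact hnext (c n)

end Game

/-- A well-founded relation has no infinite descending sequence. -/
theorem WellFounded.not_forall_descending {α : Type*} {r : α → α → Prop} (h : WellFounded r)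
    (f : ℕ → α) : ¬ ∀ n, r (f (n + 1)) (f n) := by
  intro hf
  obtain ⟨_, ⟨n, rfl⟩, hmin⟩ := h.has_min (Set.range f) ⟨f 0, 0, rfl⟩
  exact hmin (f (n + 1)) ⟨n + 1, rfl⟩ (hf n)

namespace Game

variable {A : Type u} {Q : Type v} {G : Game A Q}

/-! ### Games with the bounded depth property -/

theorem weaklyDominant_of_subset [LinearOrder A] {σ : G.Strategy} {V : Set (List A)}
    (hV : ∀ σ' : G.Strategy, FirstDiffLE shortlexRank (W σ') V) (hσ : ∀ w ∈ V, w ∈ W σ) :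
    WeaklyDominant σ := by
  have := G.finite_alphabet
  intro σ'
  rw [Language.slLe_iff_firstDiffLE]
  exact (hV σ').trans (FirstDiffLE.of_subset hσ)

instance : Finite Move :=
  Finite.of_injective (fun m : Move => match m with | .read => true | .call => false) (by
    intro m m' h
    cases m <;> cases m' <;> simp_all)

/-- A sequence of strategies has a limit along an ultrafilter. -/
theorem exists_limit (U : Ultrafilter ℕ) (s : ℕ → G.Strategy) :
    ∃ σ : G.Strategy, ∀ α a, ∀ᶠ k in (U : Filter ℕ), s k α a = σ α a := by
  choose σ hσ using fun (α : List G.Hist) (a : G.FunSym) => U.exists_eventually_eq fun k => s k α a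
  exact ⟨σ, hσ⟩

section Limit

variable {U : Ultrafilter ℕ} {s : ℕ → G.Strategy} {σ : G.Strategy}

theorem eventually_called_eq (hs : ∀ α a, ∀ᶠ k in (U : Filter ℕ), s k α a = σ α a)
    (α : List G.Hist) (a : A) :
    ∀ᶠ k in (U : Filter ℕ), called (s k) α a = called σ α a := by
  by_cases h : G.IsFun a
  · filter_upwards [hs α ⟨a, h⟩] with k hk
    simp only [called, hk]
  · exact Filter.Eventually.of_forall fun k => by simp only [called, h, dif_neg, not_false_iff]

theorem eventually_play_eq (hs : ∀ α a, ∀ᶠ k in (U : Filter ℕ), s k α a = σ α a)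
    (τ : G.Romeo) (w : List A) (n : ℕ) :
    ∀ᶠ k in (U : Filter ℕ), play (s k) τ w n = play σ τ w n := by
  induction n with
  | zero => exact Filter.Eventually.of_forall fun k => rfl
  | succ n ih =>
    obtain ⟨⟨α, r⟩, hc⟩ : ∃ c, play σ τ w n = c := ⟨_, rfl⟩
    rw [hc] at ih
    cases r with
    | nil =>
      filter_upwards [ih] with k hk
      simp only [play, hk, hc, step]
    | cons a v =>
      filter_upwards [ih, eventually_called_eq hs α a] with k hk hka
      simp only [play, hk, hc, step, hka]

theorem eventually_levels_eq (hs : ∀ α a, ∀ᶠ k in (U : Filter ℕ), s k α a = σ α a)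
    (τ : G.Romeo) (w : List A) (n : ℕ) :
    ∀ᶠ k in (U : Filter ℕ), levels (s k) τ w n = levels σ τ w n := by
  induction n with
  | zero => exact Filter.Eventually.of_forall fun k => rfl
  | succ n ih =>
    have hp := eventually_play_eq hs τ w n
    obtain ⟨⟨α, r⟩, hc⟩ : ∃ c, play σ τ w n = c := ⟨_, rfl⟩
    rw [hc] at hp
    cases r with
    | nil =>
      filter_upwards [ih, hp] with k hk hp
      simp only [levels, hk, hp, hc]
    | cons a v =>
      filter_upwards [ih, hp, eventually_called_eq hs α a] with k hk hp hka
      simp only [levels, hk, hp, hc]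
      cases levels σ τ w n <;> simp only [hka]

theorem eventually_callDepth_eq (hs : ∀ α a, ∀ᶠ k in (U : Filter ℕ), s k α a = σ α a)
    (τ : G.Romeo) (w : List A) (n : ℕ) :
    ∀ᶠ k in (U : Filter ℕ), callDepth (s k) τ w n = callDepth σ τ w n := by
  have hp := eventually_play_eq hs τ w n
  have hl := eventually_levels_eq hs τ w n
  obtain ⟨⟨α, r⟩, hc⟩ : ∃ c, play σ τ w n = c := ⟨_, rfl⟩
  rw [hc] at hp
  cases r with
  | nil =>
    filter_upwards [hl, hp] with k hk hp
    simp only [callDepth, hp, hc]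
  | cons a v =>
    filter_upwards [hl, hp, eventually_called_eq hs α a] with k hk hp hka
    simp only [callDepth, hk, hp, hc]
    cases levels σ τ w n <;> simp only [hka]

end Limit

theorem length_levels (σ : G.Strategy) (τ : G.Romeo) (w : List A) (n : ℕ) :
    (levels σ τ w n).length = (play σ τ w n).2.length := by
  induction n with
  | zero => simp [levels, play]
  | succ n ih =>
    obtain ⟨⟨α, r⟩, hc⟩ : ∃ c, play σ τ w n = c := ⟨_, rfl⟩
    obtain ⟨l, hl⟩ : ∃ l, levels σ τ w n = l := ⟨_, rfl⟩
    rw [hc, hl] at ih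
    cases r with
    | nil => simpa [levels, play, hc, hl, step] using ih
    | cons a v =>
      cases l with
      | nil => simp at ih
      | cons i l =>
        simp only [List.length_cons, add_left_inj] at ih
        simp only [levels, play, hc, hl, step]
        cases called σ α a <;> simp [ih]

/-- A play of bounded depth is finite. -/
theorem exists_play_eq_nil {σ : G.Strategy} {τ : G.Romeo} {w : List A} {B : ℕ}
    (hB : ∀ n, callDepth σ τ w n ≤ B) : ∃ n, (play σ τ w n).2 = [] := by
  by_contra! hne
  have hwf : WellFounded fun b a : ℕ => a < b ∧ b ≤ B :=
    Subrelation.wf (r := InvImage (· < ·) fun b => B - b)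
      (fun {b a} h => show B - b < B - a by omega) (InvImage.wf _ wellFounded_lt)
  refine (HeadRewrite.wellFounded hwf).not_forall_descending (levels σ τ w) fun n => ?_
  have hlen := length_levels σ τ w n
  have hd := hB n
  have hn := hne n
  obtain ⟨⟨α, r⟩, hc⟩ : ∃ c, play σ τ w n = c := ⟨_, rfl⟩
  obtain ⟨l, hl⟩ : ∃ l, levels σ τ w n = l := ⟨_, rfl⟩
  rw [hc] at hlen hn
  rw [hl] at hlen
  cases r with
  | nil => exact absurd rfl hn
  | cons a v =>
    cases l with
    | nil => simp at hlen
    | cons i l =>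
      simp only [callDepth, hc, hl] at hd
      rcases hca : called σ α a with _ | b
      · exact ⟨i, l, [], hl, by simp [levels, hc, hl, hca], by simp⟩
      · rw [hca] at hd
        refine ⟨i, l, List.replicate (τ.reply α b).length (i + 1), hl,
          by simp [levels, hc, hl, hca], fun j hj => ?_⟩
        rw [List.eq_of_mem_replicate hj]
        exact ⟨Nat.lt_succ_self i, hd⟩

/-- A limit of strategies that approximate the greatest winning set within the depth bounds: its
plays on the words of that set obey the same bounds, and are therefore finite. -/
theorem exists_weaklyDominant_of_boundedDepth [LinearOrder A] (hG : G.BoundedDepth) :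
    ∃ σ : G.Strategy, WeaklyDominant σ := by
  have := G.finite_alphabet
  obtain ⟨B, hB⟩ := hG
  obtain ⟨V, hV, happrox⟩ := FirstDiffLE.exists_greedy (f := (shortlexRank : List A → ℕ))
    shortlexRank_injective (Set.range fun σ : G.Strategy => (W σ : Set (List A)))
    ⟨_, fun _ _ => Move.read, rfl⟩
  have hk : ∀ n : ℕ, ∃ σ : G.Strategy, ∀ w ∈ V, shortlexRank w < n →
      w ∈ W σ ∧ ∀ τ : G.Romeo, depth σ τ w ≤ (B w.length : ℕ∞) := by
    intro n
    obtain ⟨_, ⟨σ, rfl⟩, hσ⟩ := happrox n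
    have hfin : {w : List A | shortlexRank w < n}.Finite :=
      Set.Finite.of_finite_image ((Set.finite_lt_nat n).subset (by
        rintro _ ⟨w, hw, rfl⟩
        exact hw)) shortlexRank_injective.injOn
    obtain ⟨k, hk⟩ := (hfin.image List.length).bddAbove
    obtain ⟨σ', hσ'⟩ := hB σ k
    exact ⟨σ', fun w hw hn => hσ' w ((hσ w hn).2 hw) (hk ⟨w, hn, rfl⟩)⟩
  choose s hs using hk
  obtain ⟨σ, hσ⟩ := exists_limit (Filter.hyperfilter ℕ) s
  refine ⟨σ, weaklyDominant_of_subset (fun σ' => hV _ ⟨σ', rfl⟩) fun w hw τ => ?_⟩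
  have hlarge : ∀ᶠ k in (Filter.hyperfilter ℕ : Filter ℕ), shortlexRank w < k := by
    refine Filter.Eventually.filter_mono Filter.hyperfilter_le_cofinite ?_
    rw [Nat.cofinite_eq_atTop]
    exact Filter.eventually_gt_atTop _
  have hdepth : ∀ n, callDepth σ τ w n ≤ B w.length := by
    intro n
    obtain ⟨k, hk, hkn⟩ := (hlarge.and (eventually_callDepth_eq hσ τ w n)).exists
    rw [← hkn]
    exact_mod_cast (le_iSup (fun n => (callDepth (s k) τ w n : ℕ∞)) n).trans ((hs k w hw hk).2 τ)
  obtain ⟨n, hn⟩ := exists_play_eq_nil hdepth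
  obtain ⟨k, hk, hkn⟩ := (hlarge.and (eventually_play_eq hσ τ w n)).exists
  -- The play of `s k` has the same final configuration.
  obtain ⟨m, hm, hacc⟩ := (hs k w hw hk).1 τ
  have hstable : ∀ (σ : G.Strategy) i j, i ≤ j → (play σ τ w i).2 = [] →
      play σ τ w j = play σ τ w i := by
    intro σ i j hij hi
    induction j, hij using Nat.le_induction with
    | base => rfl
    | succ j _ ih =>
      obtain ⟨⟨α, r⟩, hc⟩ : ∃ c, play σ τ w i = c := ⟨_, rfl⟩
      rw [hc] at hi ih
      simp only at hi
      subst hi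
      rw [play, ih, hc]
      rfl
  refine ⟨n, hn, ?_⟩
  have h1 := hstable (s k) m (max m n) (le_max_left _ _) hm
  have h2 := hstable (s k) n (max m n) (le_max_right _ _) (by rw [hkn]; exact hn)
  rw [← hkn, ← h2, h1]
  exact hacc

/-! ### Positional strategies -/

/-- The words on which Juliet can win when the target automaton starts in the state `q`. -/
def WinFrom (G : Game A Q) (q : Q) : Set (List A) :=
  {w | ∃ σ : G.Strategy, Ends σ G.T.accept [] q w}

/-- The states of the target automaton from which there is a dominant strategy. -/
def DominantState (G : Game A Q) (q : Q) : Prop :=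
  ∃ σ : G.Strategy, ∀ w ∈ G.WinFrom q, Ends σ G.T.accept [] q w

/-- Reading `a` in the state `q` never turns a winning position into a losing one, and leads to a
state from which there is a dominant strategy. -/
def ReadSafe (G : Game A Q) (q : Q) (a : A) : Prop :=
  G.DominantState (G.T.step q a) ∧ ∀ v, a :: v ∈ G.WinFrom q → v ∈ G.WinFrom (G.T.step q a)

theorem mem_winFrom_of_ends {σ : G.Strategy} {α : List G.Hist} {q : Q} {w : List A}
    (h : Ends σ G.T.accept α q w) : w ∈ G.WinFrom q :=
  ⟨residual σ α, ends_residual.2 (by simpa using h)⟩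

theorem cons_mem_winFrom {q : Q} {a : A} {v : List A} (h : v ∈ G.WinFrom (G.T.step q a)) :
    a :: v ∈ G.WinFrom q := by
  obtain ⟨σ, hσ⟩ := h
  let σ' : G.Strategy := fun α b => match α with
    | [] => Move.read
    | _ :: β => σ β b
  refine ⟨σ', Ends.read (called_eq_none.2 fun _ => rfl) ?_⟩
  have : residual σ' [Sum.inl a] = σ := rfl
  rw [← this, ends_residual] at hσ
  simpa using hσ

theorem readSafe_of_ends {σ : G.Strategy} {β : List G.Hist} {q : Q} {a : A}
    (h : ∀ v, a :: v ∈ G.WinFrom q → Ends σ G.T.accept β (G.T.step q a) v) : G.ReadSafe q a :=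
  ⟨⟨residual σ β, fun w hw => ends_residual.2 (by simpa using h w (cons_mem_winFrom hw))⟩,
    fun v hv => mem_winFrom_of_ends (h v hv)⟩

/-- From a state with a dominant strategy, every symbol that cannot safely be read can safely be
called. -/
theorem exists_called_of_not_readSafe {q : Q} {a : A} (hq : G.DominantState q)
    (ha : ¬ G.ReadSafe q a) :
    G.IsFun a ∧ ∀ v, a :: v ∈ G.WinFrom q → ∀ x ∈ G.L a, x ++ v ∈ G.WinFrom q := by
  obtain ⟨σ, hσ⟩ := hq
  rcases hc : called σ [] a with _ | b
  · exact absurd (readSafe_of_ends fun v hv => (Ends.read_iff hc).1 (hσ _ hv)) ha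
  · obtain ⟨rfl, -⟩ := called_eq_some.1 hc
    exact ⟨b.2, fun v hv x hx => mem_winFrom_of_ends ((Ends.call_iff hc).1 (hσ _ hv) x hx)⟩

open Classical in
/-- The strategy automaton that goes to the state Call instead of reading `a` in state `q` if
`C q a` holds for the function symbol `a`. From the state Call it returns to the start state, so
that words are accepted by their last letter only. -/
noncomputable def strategyDFA (G : Game A Q) (C : Q → G.FunSym → Prop) : DFA A (Option Q) where
  step
    | none, _ => some G.T.start
    | some q, a => if ∃ h : G.IsFun a, C q ⟨a, h⟩ then none else some (G.T.step q a)
  start := some G.T.start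
  accept := {none}

open Classical in
/-- The strategy that calls when the strategy automaton goes to the state Call. -/
noncomputable def positional (G : Game A Q) (C : Q → G.FunSym → Prop) : G.Strategy := fun α a =>
  if (G.strategyDFA C).eval (natural α ++ [a.1]) = none then Move.call else Move.read

theorem positional_stronglyRegular (C : Q → G.FunSym → Prop) :
    StronglyRegular (G.positional C) := by
  refine ⟨fun α β a h => by simp only [positional, h], G.strategyDFA C, rfl, rfl, fun q a => ?_, ?_⟩
  · simp only [strategyDFA]
    split_ifs <;> simp
  · ext x
    have hx : x ∈ (G.strategyDFA C).accepts ↔ (G.strategyDFA C).eval x = none := Iff.rfl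
    rw [hx]
    constructor
    · intro h
      rcases List.eq_nil_or_concat x with rfl | ⟨u, a, rfl⟩
      · cases h
      have hfun : G.IsFun a := by
        rw [List.concat_eq_append, DFA.eval_append_singleton] at h
        rcases hu : (G.strategyDFA C).eval u with _ | q
        · rw [hu] at h
          cases h
        · rw [hu] at h
          simp only [strategyDFA] at h
          split_ifs at h with hc
          exact hc.1
      have hnat : natural (u.map Sum.inl : List G.Hist) = u := by
        induction u with
        | nil => rfl
        | cons b u _ => simp [natural, List.filterMap_map, Function.comp_def]
      refine ⟨u.map Sum.inl, ⟨a, hfun⟩, ?_, by rw [hnat, List.concat_eq_append]⟩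
      simp only [positional, hnat]
      rw [List.concat_eq_append] at h
      rw [if_pos h]
    · rintro ⟨α, a, h, rfl⟩
      by_contra hne
      simp only [positional, if_neg hne] at h
      cases h

theorem called_positional_eq_some {C : Q → G.FunSym → Prop} {α : List G.Hist} {q : Q} {a : A}
    {b : G.FunSym} (hα : (G.strategyDFA C).eval (natural α) = some q)
    (h : called (G.positional C) α a = some b) : b.1 = a ∧ C q b := by
  obtain ⟨rfl, hcall⟩ := called_eq_some.1 h
  refine ⟨rfl, ?_⟩
  by_contra hC
  unfold positional at hcall
  rw [DFA.eval_append_singleton, hα, if_neg] at hcall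
  · cases hcall
  · simp [strategyDFA, hC]

theorem called_positional_eq_none {C : Q → G.FunSym → Prop} {α : List G.Hist} {q : Q} {a : A}
    (hα : (G.strategyDFA C).eval (natural α) = some q)
    (h : called (G.positional C) α a = none) : ∀ h : G.IsFun a, ¬ C q ⟨a, h⟩ := by
  intro hf hC
  have := called_eq_none.1 h hf
  unfold positional at this
  rw [DFA.eval_append_singleton, hα, if_pos] at this
  · cases this
  · simp [strategyDFA, hC, hf]

/-- The positional strategy that reads whenever this is safe. -/
noncomputable def eager (G : Game A Q) : G.Strategy := G.positional fun q b => ¬ G.ReadSafe q b.1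

/-- The configurations in which the positional strategy is to win: winning ones, in a state from
which there is a dominant strategy. -/
structure Sound (G : Game A Q) (α : List G.Hist) (q : Q) (w : List A) : Prop where
  eval_eq : (G.strategyDFA fun q b => ¬ G.ReadSafe q b.1).eval (natural α) = some q
  state_eq : q = state α
  dominant : G.DominantState q
  mem : w ∈ G.WinFrom q

theorem Sound.readSafe {α : List G.Hist} {q : Q} {a : A} {v : List A} (h : G.Sound α q (a :: v))
    (hc : called G.eager α a = none) : G.ReadSafe q a := by
  by_contra hr
  obtain ⟨hf, -⟩ := exists_called_of_not_readSafe h.dominant hr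
  exact called_positional_eq_none h.eval_eq hc hf hr

theorem Sound.not_readSafe {α : List G.Hist} {q : Q} {a : A} {v : List A} {b : G.FunSym}
    (h : G.Sound α q (a :: v)) (hc : called G.eager α a = some b) : ¬ G.ReadSafe q a := by
  obtain ⟨rfl, hb⟩ := called_positional_eq_some h.eval_eq hc
  exact hb

theorem Sound.read {α : List G.Hist} {q : Q} {a : A} {v : List A} (h : G.Sound α q (a :: v))
    (hc : called G.eager α a = none) :
    G.Sound (α ++ [Sum.inl a]) (G.T.step q a) v where
  eval_eq := by
    have := h.readSafe hc
    rw [natural_append_inl, DFA.eval_append_singleton, h.eval_eq]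
    simp [strategyDFA, this]
  state_eq := by rw [state_append_inl, h.state_eq]
  dominant := (h.readSafe hc).1
  mem := (h.readSafe hc).2 v h.mem

theorem Sound.call {α : List G.Hist} {q : Q} {a : A} {v : List A} {b : G.FunSym}
    (h : G.Sound α q (a :: v)) (hc : called G.eager α a = some b) {x : List A}
    (hx : x ∈ G.L b.1) : G.Sound (α ++ [Sum.inr b]) q (x ++ v) where
  eval_eq := by rw [natural_append_inr, h.eval_eq]
  state_eq := by rw [state_append_inr, h.state_eq]
  dominant := h.dominant
  mem := by
    have hr := h.not_readSafe hc
    obtain ⟨rfl, -⟩ := called_eq_some.1 hc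
    exact (exists_called_of_not_readSafe h.dominant hr).2 v h.mem x hx

/-- If the plays of the positional strategy that stay within the sound configurations are finite,
then it is dominant, provided there is a dominant strategy at all. -/
theorem eager_dominant (hG : ∃ σ : G.Strategy, Dominant σ)
    (hfin : ¬ ∃ c : ℕ → List G.Hist × Q × List A,
      (∀ n, G.Sound (c n).1 (c n).2.1 (c n).2.2) ∧
      ∀ n, (∃ a v, c n = ((c n).1, (c n).2.1, a :: v) ∧ called G.eager (c n).1 a = none ∧
          c (n + 1) = ((c n).1 ++ [Sum.inl a], G.T.step (c n).2.1 a, v)) ∨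
        (∃ a v b x, c n = ((c n).1, (c n).2.1, a :: v) ∧ called G.eager (c n).1 a = some b ∧
          x ∈ G.L b.1 ∧ c (n + 1) = ((c n).1 ++ [Sum.inr b], (c n).2.1, x ++ v))) :
    Dominant G.eager := by
  obtain ⟨σ, hσ⟩ := hG
  intro σ' w hw
  rw [mem_W_iff] at hw ⊢
  refine Ends.of_invariant G.Sound ?_ (fun α q a v h hc => h.read hc)
    (fun α q a v b h hc x hx => h.call hc hx) hfin ⟨rfl, rfl, ?_, ⟨σ', hw⟩⟩
  · rintro α q h
    obtain ⟨σ, hσ⟩ := h.mem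
    exact Ends.nil_iff.1 hσ
  · refine ⟨σ, fun w hw => ?_⟩
    obtain ⟨σ'', hw⟩ := hw
    exact mem_W_iff.1 (hσ σ'' w (mem_W_iff.2 hw))

/-! ### Non-recursive games -/

theorem NonRecursive.wellFounded (hG : G.NonRecursive) :
    WellFounded fun b a : A => ∃ x ∈ G.L a, b ∈ x := by
  have := G.finite_alphabet
  rw [wellFounded_iff_isEmpty_descending_chain]
  refine ⟨fun ⟨f, hf⟩ => hG ?_⟩
  have hfun : ∀ k, G.IsFun (f k) := fun k => by
    obtain ⟨x, hx, -⟩ := hf k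
    exact ⟨x, hx⟩
  obtain ⟨i, j, hij, heq⟩ : ∃ i j, i < j ∧ f i = f j := by
    obtain ⟨i, j, hne, heq⟩ := Finite.exists_ne_map_eq_of_infinite f
    rcases lt_or_gt_of_ne hne with h | h
    · exact ⟨i, j, h, heq⟩
    · exact ⟨j, i, h, heq.symm⟩
  refine ⟨j - i, fun k => ⟨f (i + k), hfun _⟩, by omega, ?_, fun k _ => hf (i + k)⟩
  simp only [Subtype.mk.injEq, add_zero]
  rw [heq]
  congr 1
  omega

/-- In a non-recursive game, each move rewrites the head of the remaining string by smaller symbols,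
so there are no infinite plays. -/
theorem eager_dominant_of_nonRecursive (hG : G.NonRecursive)
    (hdom : ∃ σ : G.Strategy, Dominant σ) : Dominant G.eager := by
  refine eager_dominant hdom ?_
  rintro ⟨c, -, hc⟩
  refine (HeadRewrite.wellFounded hG.wellFounded).not_forall_descending (fun n => (c n).2.2) ?_
  intro n
  rcases hc n with ⟨a, v, h1, -, h2⟩ | ⟨a, v, b, x, h1, hb, hx, h2⟩
  · exact ⟨a, v, [], by rw [h1], by rw [h2]; rfl, by simp⟩
  · obtain ⟨rfl, -⟩ := called_eq_some.1 hb
    exact ⟨b.1, v, x, by rw [h1], by rw [h2], fun d hd => ⟨x, hx, hd⟩⟩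

/-! ### Games with finite target language -/

/-- Replacement words are non-empty, so the remaining string never becomes shorter than the part of
the final string that results from it. -/
theorem exists_length_le_of_ends {σ : G.Strategy} {S : Set Q} {α : List G.Hist} {q : Q}
    {w : List A} (h : Ends σ S α q w) : ∃ z : List A, w.length ≤ z.length ∧ G.T.evalFrom q z ∈ S := by
  induction h with
  | nil hq => exact ⟨[], le_rfl, hq⟩
  | @read α q a v _ _ ih =>
    obtain ⟨z, hz, hz'⟩ := ih
    exact ⟨a :: z, by simpa using hz, by simpa using hz'⟩
  | @call α q a v b _ _ ih =>
    obtain ⟨x, hx⟩ := b.2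
    obtain ⟨z, hz, hz'⟩ := ih x hx
    have := List.length_pos_of_ne_nil (G.ne_nil _ _ hx)
    refine ⟨z, ?_, hz'⟩
    simp only [List.length_append, List.length_cons] at hz ⊢
    omega

/-- If Romeo can reply to every call by a single symbol, again and again, then one of these symbols
can safely be read: a dominant strategy has to read one of them, and when the symbols recur, the
calls before do not gain anything. -/
theorem exists_readSafe_of_unit_replies {q : Q} (hq : G.DominantState q) {a : ℕ → A}
    (ha : ∀ k, [a (k + 1)] ∈ G.L (a k)) {v : List A} (hv : a 0 :: v ∈ G.WinFrom q) :
    ∃ k, G.ReadSafe q (a k) := by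
  by_contra! hno
  have := G.finite_alphabet
  have hmono : ∀ u k, a k :: u ∈ G.WinFrom q → ∀ j, a (k + j) :: u ∈ G.WinFrom q := by
    intro u k hk j
    induction j with
    | zero => exact hk
    | succ j ih => exact (exists_called_of_not_readSafe hq (hno (k + j))).2 u ih _ (ha (k + j))
  obtain ⟨d, hd⟩ := Finite.exists_infinite_fiber a
  have hd' : (a ⁻¹' {d}).Infinite := Set.infinite_coe_iff.1 hd
  obtain ⟨i, hi⟩ := hd'.nonempty
  have hback : ∀ u k, a (i + k) :: u ∈ G.WinFrom q → a i :: u ∈ G.WinFrom q := by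
    intro u k hk
    obtain ⟨j, hj, hjk⟩ := hd'.exists_gt (i + k)
    have := hmono u (i + k) hk (j - (i + k))
    rw [Nat.add_sub_cancel' hjk.le, (show a j = d from hj)] at this
    rwa [(show a i = d from hi)]
  obtain ⟨σ, hσ⟩ := id hq
  have hf : ∀ k, G.IsFun (a k) := fun k => ⟨_, ha k⟩
  let h : ℕ → List G.Hist := fun k => (List.range k).map fun j => Sum.inr ⟨a (i + j), hf (i + j)⟩
  have hsucc : ∀ k, h (k + 1) = h k ++ [Sum.inr ⟨a (i + k), hf (i + k)⟩] := by
    intro k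
    simp [h, List.range_succ]
  have hcalled : ∃ k, called σ (h k) (a (i + k)) = none := by
    by_contra! hall
    have key : ∀ α q w, Ends σ G.T.accept α q w → ∀ k, α = h k → w ≠ a (i + k) :: v := by
      intro α q w hE
      induction hE with
      | nil _ => intro k _ h; cases h
      | read hc _ _ =>
        rintro k rfl heq
        obtain ⟨rfl, -⟩ := List.cons.inj heq
        exact hall k hc
      | call hc _ ih =>
        rintro k rfl heq
        obtain ⟨rfl, rfl⟩ := List.cons.inj heq
        obtain ⟨hb, -⟩ := called_eq_some.1 hc
        refine ih [a (i + k + 1)] (by rw [hb]; exact ha _) (k + 1) ?_ rfl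
        rw [hsucc, Subtype.ext (a2 := ⟨a (i + k), hf (i + k)⟩) hb]
    exact key _ _ _ (hσ _ (by simpa using hmono v 0 hv i)) 0 rfl rfl
  classical
  let k := Nat.find hcalled
  have hprefix : ∀ u, a i :: u ∈ G.WinFrom q → ∀ j ≤ k,
      Ends σ G.T.accept (h j) q (a (i + j) :: u) := by
    intro u hu j
    induction j with
    | zero => exact fun _ => hσ _ hu
    | succ j ih =>
      intro hj
      have hE := ih (by omega)
      have hc := Nat.find_min hcalled (m := j) (by omega)
      obtain ⟨b, hb⟩ := Option.ne_none_iff_exists'.1 hc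
      obtain ⟨hb', -⟩ := called_eq_some.1 hb
      have hbe : b = ⟨a (i + j), hf (i + j)⟩ := Subtype.ext hb'
      subst hbe
      rw [hsucc]
      exact (Ends.call_iff hb).1 hE _ (ha _)
  refine hno (i + k) (readSafe_of_ends (σ := σ) (β := h k ++ [Sum.inl (a (i + k))]) fun u hu => ?_)
  exact (Ends.read_iff (Nat.find_spec hcalled)).1 (hprefix u (hback u k hu) k le_rfl)

/-- From a winning configuration, the number of symbols read or remaining is at most the length of a
word of the target language. In an infinite play it is thus eventually constant, which leaves only
calls with replies of length one. -/
theorem eager_dominant_of_finiteTarget (hG : G.FiniteTarget)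
    (hdom : ∃ σ : G.Strategy, Dominant σ) : Dominant G.eager := by
  refine eager_dominant hdom ?_
  rintro ⟨c, hsound, hc⟩
  obtain ⟨m, hm⟩ := (hG.image List.length).bddAbove
  let f : ℕ → ℕ := fun n => (natural (c n).1).length
  let g : ℕ → ℕ := fun n => f n + (c n).2.2.length
  have hg : ∀ n, g n ≤ m := by
    intro n
    obtain ⟨σ, hσ⟩ := (hsound n).mem
    obtain ⟨z, hz, hz'⟩ := exists_length_le_of_ends hσ
    have hacc : natural (c n).1 ++ z ∈ G.T.accepts := by
      rw [DFA.mem_accepts, DFA.eval, DFA.evalFrom_of_append]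
      rwa [(hsound n).state_eq] at hz'
    have := hm ⟨_, hacc, rfl⟩
    simp only [List.length_append] at this
    simp only [g, f]
    omega
  have hstep : ∀ n, f n ≤ f (n + 1) ∧ g n ≤ g (n + 1) ∧
      (f (n + 1) = f n → g (n + 1) = g n → ∃ a b v, (c n).2.2 = a :: v ∧ (c (n + 1)).2.2 = b :: v ∧
        [b] ∈ G.L a ∧ (c (n + 1)).2.1 = (c n).2.1 ∧ ¬ G.ReadSafe (c n).2.1 a) := by
    intro n
    rcases hc n with ⟨a, v, h1, -, h2⟩ | ⟨a, v, b, x, h1, hb, hx, h2⟩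
    · have hw : (c n).2.2 = a :: v := by rw [h1]
      have hf : f (n + 1) = f n + 1 := by
        simp only [f, h2, natural_append_inl, List.length_append, List.length_singleton]
      refine ⟨by omega, ?_, fun h => by omega⟩
      simp only [g, hf, hw, h2, List.length_cons]
      omega
    · have hw : (c n).2.2 = a :: v := by rw [h1]
      have hf : f (n + 1) = f n := by simp only [f, h2, natural_append_inr]
      have hpos := List.length_pos_of_ne_nil (G.ne_nil _ _ hx)
      have hs := hsound n
      rw [hw] at hs
      have hr := hs.not_readSafe hb
      obtain ⟨rfl, -⟩ := called_eq_some.1 hb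
      refine ⟨hf.ge, ?_, fun _ hgn => ?_⟩
      · simp only [g, hf, hw, h2, List.length_cons, List.length_append]
        omega
      · simp only [g, hf, hw, h2, List.length_cons, List.length_append] at hgn
        obtain ⟨d, rfl⟩ := List.length_eq_one_iff.1 (show x.length = 1 by omega)
        exact ⟨b.1, d, v, hw, by rw [h2]; rfl, hx, by rw [h2], hr⟩
  -- Both lengths are eventually constant.
  obtain ⟨N, hN⟩ : ∃ N, ∀ n, N ≤ n → f n = f N ∧ g n = g N := by
    have hbdd : BddAbove (Set.range fun n => f n + g n) := by
      refine ⟨m + m, ?_⟩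
      rintro _ ⟨n, rfl⟩
      have := hg n
      simp only [g] at this ⊢
      omega
    obtain ⟨N, hN⟩ := Nat.sSup_mem (Set.range_nonempty fun n => f n + g n) hbdd
    refine ⟨N, fun n hn => ?_⟩
    have h1 := monotone_nat_of_le_succ (fun n => (hstep n).1) hn
    have h2 := monotone_nat_of_le_succ (fun n => (hstep n).2.1) hn
    have h3 : f n + g n ≤ f N + g N := by
      rw [show f N + g N = _ from hN]
      exact le_csSup hbdd ⟨n, rfl⟩
    omega
  have hunit : ∀ k, ∃ a b v, (c (N + k)).2.2 = a :: v ∧ (c (N + k + 1)).2.2 = b :: v ∧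
        [b] ∈ G.L a ∧ (c (N + k + 1)).2.1 = (c (N + k)).2.1 ∧ ¬ G.ReadSafe (c (N + k)).2.1 a := by
    intro k
    have h1 := hN (N + k) (by omega)
    have h2 := hN (N + k + 1) (by omega)
    exact (hstep (N + k)).2.2 (by omega) (by omega)
  choose a b v hw hw' hL hqe hr using hunit
  have hab : ∀ k, b k = a (k + 1) := fun k => by
    have := (hw' k).symm.trans (hw (k + 1))
    exact (List.cons.inj this).1
  have hq : ∀ k, (c (N + k)).2.1 = (c N).2.1 := by
    intro k
    induction k with
    | zero => rfl
    | succ k ih => exact (hqe k).trans ih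
  obtain ⟨k, hk⟩ := exists_readSafe_of_unit_replies (hsound N).dominant (a := a)
    (fun k => by rw [← hab]; exact hL k) (v := v 0) (by
      have := (hsound N).mem
      rw [show (c N).2.2 = a 0 :: v 0 from hw 0] at this
      exact this)
  exact hr k (by rw [hq]; exact hk)

end Game

/-! ### Unary games as sequences of moves -/

namespace UnaryGame

/-- Winning in a unary game. Juliet's strategy is a sequence `m` of moves (`true` for Call), as the
history does not reveal Romeo's replies. `Win e Y m t ρ r`: after `t` moves, with `ρ` symbols read
and `r` symbols remaining, every play is finite and the total number of symbols read satisfies `e`,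
where Romeo may replace a called symbol by `y + 1` symbols for any `y ∈ Y`. -/
inductive Win (e : ℕ → Prop) (Y : Set ℕ) (m : ℕ → Bool) : ℕ → ℕ → ℕ → Prop
  | nil {t ρ : ℕ} : e ρ → Win e Y m t ρ 0
  | read {t ρ r : ℕ} : m t = false → Win e Y m (t + 1) (ρ + 1) r → Win e Y m t ρ (r + 1)
  | call {t ρ r : ℕ} : m t = true → (∀ y ∈ Y, Win e Y m (t + 1) ρ (r + 1 + y)) →
      Win e Y m t ρ (r + 1)

/-- The lengths of the input words on which the sequence of moves wins. -/
def winSet (e : ℕ → Prop) (Y : Set ℕ) (m : ℕ → Bool) : Set ℕ := {n | Win e Y m 0 0 n}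

variable {e : ℕ → Prop} {Y : Set ℕ} {m m' : ℕ → Bool} {m₀ c : ℕ}

namespace Win

theorem nil_iff {t ρ : ℕ} : Win e Y m t ρ 0 ↔ e ρ :=
  ⟨fun h => by cases h; assumption, nil⟩

theorem read_iff {t ρ r : ℕ} (h : m t = false) :
    Win e Y m t ρ (r + 1) ↔ Win e Y m (t + 1) (ρ + 1) r := by
  refine ⟨fun hw => ?_, read h⟩
  cases hw with
  | read _ hw => exact hw
  | call h' => rw [h] at h'; cases h'

theorem call_iff {t ρ r : ℕ} (h : m t = true) :
    Win e Y m t ρ (r + 1) ↔ ∀ y ∈ Y, Win e Y m (t + 1) ρ (r + 1 + y) := by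
  refine ⟨fun hw => ?_, call h⟩
  cases hw with
  | read h' _ => rw [h] at h'; cases h'
  | call _ hw => exact hw

theorem reads_iff {k : ℕ} : ∀ {t ρ r : ℕ}, (∀ i < k, m (t + i) = false) →
    (Win e Y m t ρ (r + k) ↔ Win e Y m (t + k) (ρ + k) r) := by
  induction k with
  | zero => intro t ρ r _; rfl
  | succ k ih =>
    intro t ρ r h
    rw [← add_assoc, read_iff (t := t) (h 0 (by omega)), ih fun i hi => ?_]
    · rw [show t + 1 + k = t + (k + 1) by ring, show ρ + 1 + k = ρ + (k + 1) by ring]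
    · rw [show t + 1 + i = t + (i + 1) by ring]
      exact h _ (by omega)

theorem iff_of_reads {t ρ r : ℕ} (h : ∀ i < r, m (t + i) = false) :
    Win e Y m t ρ r ↔ e (ρ + r) := by
  have := reads_iff (e := e) (Y := Y) (ρ := ρ) (r := 0) h
  rw [zero_add] at this
  rw [this, nil_iff]

theorem of_calls {k : ℕ} : ∀ {t ρ r : ℕ}, 1 ≤ r → (∀ i < k, m (t + i) = true) →
    (∀ y : ℕ → ℕ, (∀ i, y i ∈ Y) → Win e Y m (t + k) ρ (r + ∑ i ∈ Finset.range k, y i)) →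
    Y.Nonempty → Win e Y m t ρ r := by
  induction k with
  | zero =>
    rintro t ρ r - - hw ⟨y, hy⟩
    simpa using hw (fun _ => y) fun _ => hy
  | succ k ih =>
    intro t ρ r hr h hw hY
    obtain ⟨r, rfl⟩ : ∃ r', r = r' + 1 := ⟨r - 1, by omega⟩
    refine call (h 0 (by omega)) fun y hy => ih (by omega) (fun i hi => ?_) (fun z hz => ?_) hY
    · rw [show t + 1 + i = t + (i + 1) by ring]
      exact h _ (by omega)
    · have := hw (fun i => Nat.casesOn i y z) (fun i => by cases i; exacts [hy, hz _])
      rw [Finset.sum_range_succ'] at this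
      rw [show t + 1 + k = t + (k + 1) by ring]
      convert this using 1
      simp only [add_assoc]
      congr 2
      exact add_comm _ _

/-- The win depends on the remaining moves only. -/
theorem congr_tail {t ρ r : ℕ} (h : Win e Y m t ρ r) : ∀ {t' : ℕ}, (∀ i, m (t + i) = m' (t' + i)) →
    Win e Y m' t' ρ r := by
  induction h with
  | nil he => exact fun _ => nil he
  | @read t ρ r hm _ ih =>
    intro t' heq
    refine read ((heq 0).symm.trans hm) (ih fun i => ?_)
    rw [add_right_comm, add_right_comm t']
    exact heq (i + 1)
  | @call t ρ r hm _ ih =>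
    intro t' heq
    refine call ((heq 0).symm.trans hm) fun y hy => ih y hy fun i => ?_
    rw [add_right_comm, add_right_comm t']
    exact heq (i + 1)

theorem congr_modEq (he : ∀ k k', m₀ ≤ k → m₀ ≤ k' → k ≡ k' [MOD c] → (e k ↔ e k')) {t ρ r : ℕ}
    (h : Win e Y m t ρ r) : ∀ {ρ' : ℕ}, m₀ ≤ ρ → m₀ ≤ ρ' → ρ ≡ ρ' [MOD c] → Win e Y m t ρ' r := by
  induction h with
  | nil hρ => exact fun h1 h2 h3 => nil ((he _ _ h1 h2 h3).1 hρ)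
  | read hm _ ih => exact fun h1 h2 h3 => read hm (ih (by omega) (by omega) (h3.add_right 1))
  | call hm _ ih => exact fun h1 h2 h3 => call hm fun y hy => ih y hy h1 h2 h3

end Win

theorem winSet_reads : winSet e Y (fun _ => false) = {n | e n} := by
  ext n
  exact (Win.iff_of_reads fun _ _ => rfl).trans (by rw [zero_add]; rfl)

/-! ### Unary games with two replies whose lengths differ by at least the period -/

/-- Two windows of the length of the period contain equally many members of the target, so neither
can be properly contained in the other. -/
theorem exists_of_not_of_card (hc : 1 ≤ c) (hper : ∀ k, m₀ ≤ k → (e (k + c) ↔ e k)) {n k : ℕ}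
    (hn : m₀ ≤ n) (hk : m₀ ≤ k) (hen : ¬ e n) (hek : e k) : ∃ h < c, e (n + h) ∧ ¬ e (k + h) := by
  classical
  by_contra! hsub
  have hcard : ∀ n, m₀ ≤ n →
      ((Finset.range c).filter fun h => e (n + h)).card = c.count fun k => e (m₀ + k) := by
    intro n hn
    rw [← Nat.filter_Ico_card_eq_of_periodic (n - m₀) c (fun k => e (m₀ + k)) fun k =>
      propext (by
        change e (m₀ + (k + c)) ↔ e (m₀ + k)
        rw [← add_assoc]
        exact hper _ (by omega))]
    refine Finset.card_bij (fun h _ => n - m₀ + h) ?_ ?_ ?_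
    · intro h hh
      simp only [Finset.mem_filter, Finset.mem_range, Finset.mem_Ico] at hh ⊢
      rw [show m₀ + (n - m₀ + h) = n + h by omega]
      exact ⟨by omega, hh.2⟩
    · intro h _ h' _ heq
      omega
    · intro b hb
      simp only [Finset.mem_filter, Finset.mem_range, Finset.mem_Ico] at hb ⊢
      refine ⟨b - (n - m₀), ⟨by omega, ?_⟩, by omega⟩
      rw [show n + (b - (n - m₀)) = m₀ + b by omega]
      exact hb.2
  have hle : (Finset.range c).filter (fun h => e (n + h)) ⊆
      (Finset.range c).filter (fun h => e (k + h)) := fun h hh => by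
    simp only [Finset.mem_filter, Finset.mem_range] at hh ⊢
    exact ⟨hh.1, hsub h hh.1 hh.2⟩
  have heq := Finset.eq_of_subset_of_card_le hle (by rw [hcard n hn, hcard k hk])
  have : 0 ∈ (Finset.range c).filter (fun h => e (k + h)) := by
    simp only [Finset.mem_filter, Finset.mem_range, add_zero]
    exact ⟨by omega, hek⟩
  rw [← heq] at this
  simp only [Finset.mem_filter, add_zero] at this
  exact hen this.2

/-- If all members `n + h` of the target lead to winning positions `r + h`, while `n` is not in the
target, then no further symbol of `r` is called. At a last call, the replies `y` and `y'` would both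
have to be read to the end, and thus all positions in between; but as many residues are winning for
`y` as there are in the target. -/
theorem Win.reads_of_forall (hc : 1 ≤ c) (hper : ∀ k, m₀ ≤ k → (e (k + c) ↔ e k)) {y y' : ℕ}
    (hy : y ∈ Y) (hy' : y' ∈ Y) (hyy : y + c ≤ y') {n : ℕ} (hn : m₀ ≤ n) (hen : ¬ e n)
    {t ρ r : ℕ} (h : Win e Y m t ρ r) (hm₀ : m₀ ≤ ρ + r)
    (hall : ∀ h, e (n + h) → Win e Y m t ρ (r + h)) : ∀ i < r, m (t + i) = false := by
  induction h with
  | nil _ => intro i hi; omega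
  | @read t ρ r hm _ ih =>
    intro i hi
    cases i with
    | zero => exact hm
    | succ i =>
      rw [← add_assoc, add_right_comm]
      refine ih (by omega) (fun h hh => ?_) i (by omega)
      have := hall h hh
      rwa [add_right_comm, Win.read_iff hm] at this
  | @call t ρ r hm hw ih =>
    exfalso
    have hall' : ∀ h, e (n + h) → ∀ z ∈ Y, Win e Y m (t + 1) ρ (r + 1 + z + h) := by
      intro h hh z hz
      have := hall h hh
      rw [add_right_comm, Win.call_iff hm] at this
      convert this z hz using 1
      ring
    have hreads := ih y' hy' (by omega) fun h hh => hall' h hh y' hy'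
    have hk : e (ρ + (r + 1 + y)) :=
      (Win.iff_of_reads fun i hi => hreads i (by omega)).1 (hw y hy)
    obtain ⟨h, hlt, hnh, hkh⟩ := exists_of_not_of_card hc hper hn (by omega) hen hk
    apply hkh
    rw [add_assoc]
    exact (Win.iff_of_reads fun i hi => hreads i (by omega)).1 (hall' h hnh y hy)

/-- Strategies that win wherever reading everything does can gain only short words. -/
theorem mem_of_mem_winSet (hc : 1 ≤ c) (hper : ∀ k, m₀ ≤ k → (e (k + c) ↔ e k)) {y y' : ℕ}
    (hy : y ∈ Y) (hy' : y' ∈ Y) (hyy : y + c ≤ y') (hm : {n | e n} ⊆ winSet e Y m) {n : ℕ}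
    (hn : m₀ ≤ n) (hw : n ∈ winSet e Y m) : e n := by
  by_contra hen
  have := Win.reads_of_forall hc hper hy hy' hyy hn hen hw (by omega) fun h hh => hm hh
  have := (Win.iff_of_reads this).1 hw
  rw [zero_add] at this
  exact hen this

/-- Among the sequences of moves that win wherever reading everything does, one with the most wins
below `m₀` is undominated. -/
theorem exists_maximal_of_add_le (hc : 1 ≤ c) (hper : ∀ k, m₀ ≤ k → (e (k + c) ↔ e k))
    {y y' : ℕ} (hy : y ∈ Y) (hy' : y' ∈ Y) (hyy : y + c ≤ y') :
    ∃ m, ∀ m', winSet e Y m ⊆ winSet e Y m' → winSet e Y m = winSet e Y m' := by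
  let S : Set ℕ := {k | ∃ m, {n | e n} ⊆ winSet e Y m ∧ k = (winSet e Y m ∩ Set.Iio m₀).ncard}
  have hfin : (Set.Iio m₀).Finite := Set.finite_Iio m₀
  have hbdd : BddAbove S := by
    refine ⟨(Set.Iio m₀).ncard, ?_⟩
    rintro _ ⟨m, -, rfl⟩
    exact Set.ncard_le_ncard Set.inter_subset_right hfin
  obtain ⟨m, hm, hcard⟩ := Nat.sSup_mem (s := S) ⟨_, _, winSet_reads.ge, rfl⟩ hbdd
  refine ⟨m, fun m' hmm' => hmm'.antisymm fun n hn => ?_⟩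
  by_cases hlt : n < m₀
  · have heq := Set.eq_of_subset_of_ncard_le
      (Set.inter_subset_inter_left (Set.Iio m₀) hmm')
      (by rw [← hcard]; exact le_csSup hbdd ⟨m', hm.trans hmm', rfl⟩)
      (hfin.subset Set.inter_subset_right)
    have : n ∈ winSet e Y m' ∩ Set.Iio m₀ := ⟨hn, hlt⟩
    rw [← heq] at this
    exact this.1
  · exact hm (mem_of_mem_winSet hc hper hy hy' hyy (hm.trans hmm') (not_lt.1 hlt) hn)

/-! ### Unary games with a reply of length one -/

theorem Win.of_zero_mem (h0 : 0 ∈ Y) {t ρ r : ℕ} (h : Win e Y m t ρ r) : e (ρ + r) := by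
  induction h with
  | nil he => exact he
  | read _ _ ih => rwa [add_assoc, add_comm 1] at ih
  | call _ _ ih => exact ih 0 h0

theorem exists_maximal_of_zero_mem (h0 : 0 ∈ Y) :
    ∃ m, ∀ m', winSet e Y m ⊆ winSet e Y m' → winSet e Y m = winSet e Y m' := by
  refine ⟨fun _ => false, fun m' h => h.antisymm ?_⟩
  rw [winSet_reads]
  intro n hn
  have := Win.of_zero_mem h0 hn
  rwa [zero_add] at this

/-! ### Unary games with finitely many replies of length at least two -/

/-- The number of calls among the first `t` moves. -/
def calls (m : ℕ → Bool) : ℕ → ℕ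
  | 0 => 0
  | t + 1 => calls m t + if m t then 1 else 0

/-- The number of reads among the first `t` moves. -/
def reads (m : ℕ → Bool) : ℕ → ℕ
  | 0 => 0
  | t + 1 => reads m t + if m t then 0 else 1

theorem calls_succ_of_call {t : ℕ} (h : m t = true) : calls m (t + 1) = calls m t + 1 := by
  simp [calls, h]

theorem calls_succ_of_read {t : ℕ} (h : m t = false) : calls m (t + 1) = calls m t := by
  simp [calls, h]

theorem reads_succ_of_call {t : ℕ} (h : m t = true) : reads m (t + 1) = reads m t := by
  simp [reads, h]

theorem reads_succ_of_read {t : ℕ} (h : m t = false) : reads m (t + 1) = reads m t + 1 := by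
  simp [reads, h]

theorem calls_add_reads (m : ℕ → Bool) (t : ℕ) : calls m t + reads m t = t := by
  induction t with
  | zero => rfl
  | succ t ih =>
    cases h : m t
    · rw [calls_succ_of_read h, reads_succ_of_read h]; omega
    · rw [calls_succ_of_call h, reads_succ_of_call h]; omega

theorem calls_mono (m : ℕ → Bool) : Monotone (calls m) :=
  monotone_nat_of_le_succ fun t => by simp [calls]

theorem reads_mono (m : ℕ → Bool) : Monotone (reads m) :=
  monotone_nat_of_le_succ fun t => by simp [reads]

theorem calls_congr {t : ℕ} (h : ∀ i < t, m i = m' i) : calls m t = calls m' t := by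
  induction t with
  | zero => rfl
  | succ t ih => simp only [calls]; rw [ih fun i hi => h i (by omega), h t (by omega)]

theorem reads_congr {t : ℕ} (h : ∀ i < t, m i = m' i) : reads m t = reads m' t := by
  induction t with
  | zero => rfl
  | succ t ih => simp only [reads]; rw [ih fun i hi => h i (by omega), h t (by omega)]

theorem calls_shift {a b : ℕ} (h : ∀ i, m (a + i) = m' (b + i)) (i : ℕ) :
    calls m (a + i) + calls m' b = calls m' (b + i) + calls m a := by
  induction i with
  | zero => simp only [add_zero]; omega
  | succ i ih => rw [← add_assoc, ← add_assoc, calls, calls, h]; omega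

theorem reads_shift {a b : ℕ} (h : ∀ i, m (a + i) = m' (b + i)) (i : ℕ) :
    reads m (a + i) + reads m' b = reads m' (b + i) + reads m a := by
  induction i with
  | zero => simp only [add_zero]; omega
  | succ i ih => rw [← add_assoc, ← add_assoc, reads, reads, h]; omega

/-- If `D` is the largest of Romeo's replies, then the play on the input length `n` in which he
always replies `D` has ended after at most `t` moves. -/
def Dead (D : ℕ) (m : ℕ → Bool) (n t : ℕ) : Prop := n + D * calls m t ≤ reads m t

/-- `p` is a possible development of the number of remaining symbols between the moves `a` and
`b`. Only differences matter, and they are not required to be positive. -/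
def IsPath (Y : Set ℕ) (m : ℕ → Bool) (a b : ℕ) (p : ℕ → ℕ) : Prop :=
  ∀ i, a ≤ i → i < b → (m i = true → ∃ y ∈ Y, p (i + 1) = p i + y) ∧
    (m i = false → p (i + 1) + 1 = p i)

theorem IsPath.congr {a b : ℕ} {p : ℕ → ℕ} (hp : IsPath Y m a b p) (h : ∀ i < b, m i = m' i) :
    IsPath Y m' a b p := fun i hi hib => by
  rw [← h i hib]
  exact hp i hi hib

theorem IsPath.le {D a b : ℕ} {p : ℕ → ℕ} (hp : IsPath Y m a b p) (hD : ∀ y ∈ Y, y ≤ D)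
    (hab : a ≤ b) : p b + reads m b + D * calls m a ≤ p a + reads m a + D * calls m b := by
  induction b, hab using Nat.le_induction with
  | base => omega
  | succ b hb ih =>
    have hprev := ih fun i hi hib => hp i hi (by omega)
    obtain ⟨h1, h2⟩ := hp b hb (by omega)
    cases h : m b
    · rw [calls_succ_of_read h, reads_succ_of_read h]
      have := h2 h
      omega
    · rw [calls_succ_of_call h, reads_succ_of_call h]
      obtain ⟨y, hy, heq⟩ := h1 h
      have := hD y hy
      rw [mul_add]
      omega

theorem IsPath.ge {d a b : ℕ} {p : ℕ → ℕ} (hp : IsPath Y m a b p) (hd : ∀ y ∈ Y, d ≤ y)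
    (hab : a ≤ b) : p a + reads m a + d * calls m b ≤ p b + reads m b + d * calls m a := by
  induction b, hab using Nat.le_induction with
  | base => omega
  | succ b hb ih =>
    have hprev := ih fun i hi hib => hp i hi (by omega)
    obtain ⟨h1, h2⟩ := hp b hb (by omega)
    cases h : m b
    · rw [calls_succ_of_read h, reads_succ_of_read h]
      have := h2 h
      omega
    · rw [calls_succ_of_call h, reads_succ_of_call h]
      obtain ⟨y, hy, heq⟩ := h1 h
      have := hd y hy
      rw [mul_add]
      omega

theorem Win.along_path {a b κ r : ℕ} {p : ℕ → ℕ} (hp : IsPath Y m a b p) (hab : a ≤ b)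
    (hr : 1 ≤ r) (h : Win e Y m a (κ + reads m a) (r + p a)) :
    Win e Y m b (κ + reads m b) (r + p b) := by
  induction b, hab using Nat.le_induction with
  | base => exact h
  | succ b hb ih =>
    have hprev := ih fun i hi hib => hp i hi (by omega)
    obtain ⟨h1, h2⟩ := hp b hb (by omega)
    obtain ⟨s, hs⟩ : ∃ s, r + p b = s + 1 := ⟨r + p b - 1, by omega⟩
    rw [hs] at hprev
    cases hm : m b
    · rw [Win.read_iff hm] at hprev
      have := h2 hm
      rw [reads_succ_of_read hm, ← add_assoc, show r + p (b + 1) = s by omega]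
      exact hprev
    · rw [Win.call_iff hm] at hprev
      obtain ⟨y, hy, heq⟩ := h1 hm
      have := hprev y hy
      rw [reads_succ_of_call hm, heq, show r + (p b + y) = s + 1 + y by omega]
      exact this

theorem Win.exists_dead {D t ρ n : ℕ} (hD : D ∈ Y) (h : Win e Y m t ρ n) :
    ∃ t', t ≤ t' ∧ n + D * calls m t' + reads m t ≤ reads m t' + D * calls m t := by
  induction h with
  | nil _ => exact ⟨_, le_rfl, by omega⟩
  | read hm _ ih =>
    obtain ⟨t', ht, hle⟩ := ih
    rw [calls_succ_of_read hm, reads_succ_of_read hm] at hle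
    exact ⟨t', by omega, by omega⟩
  | call hm _ ih =>
    obtain ⟨t', ht, hle⟩ := ih D hD
    rw [calls_succ_of_call hm, reads_succ_of_call hm, mul_add] at hle
    exact ⟨t', by omega, by omega⟩

/-- A win on the length `n` depends only on the moves until the longest play on `n` has ended. -/
theorem Win.of_agree {D T s ρ n : ℕ} (hD : ∀ y ∈ Y, y ≤ D) (hagree : ∀ i < T, m i = m' i)
    (h : Win e Y m' s ρ n) : s ≤ T → n + D * calls m T + reads m s ≤ reads m T + D * calls m s →
    Win e Y m s ρ n := by
  induction h with
  | nil he => exact fun _ _ => nil he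
  | @read s ρ n hm _ ih =>
    intro hs hle
    have hsT : s < T := by
      rcases hs.lt_or_eq with h | rfl
      · exact h
      · omega
    have hms := (hagree s hsT).trans hm
    refine read hms (ih hsT ?_)
    rw [calls_succ_of_read hms, reads_succ_of_read hms]
    omega
  | @call s ρ n hm _ ih =>
    intro hs hle
    have hsT : s < T := by
      rcases hs.lt_or_eq with h | rfl
      · exact h
      · omega
    have hms := (hagree s hsT).trans hm
    refine call hms fun y hy => ih y hy hsT ?_
    have := hD y hy
    rw [calls_succ_of_call hms, reads_succ_of_call hms, mul_add]
    omega

theorem Win.of_prefix {a : ℕ} (hagree : ∀ i < a, m i = m' i)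
    (htail : ∀ r, 1 ≤ r → Win e Y m a (reads m a) r → Win e Y m' a (reads m a) r) {t ρ r : ℕ}
    (h : Win e Y m t ρ r) : ρ = reads m t → t ≤ a → Win e Y m' t ρ r := by
  have hlast : ∀ ρ r, 1 ≤ r → ρ = reads m a → Win e Y m a ρ r → Win e Y m' a ρ r := by
    rintro ρ r hr rfl h
    exact htail r hr h
  induction h with
  | nil he => exact fun _ _ => nil he
  | @read t ρ r hm h ih =>
    intro hρ ht
    rcases ht.lt_or_eq with hlt | rfl
    · refine read ((hagree t hlt).symm.trans hm) (ih ?_ hlt)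
      rw [hρ, reads_succ_of_read hm]
    · exact hlast _ _ (by omega) hρ (read hm h)
  | @call t ρ r hm h ih =>
    intro hρ ht
    rcases ht.lt_or_eq with hlt | rfl
    · refine call ((hagree t hlt).symm.trans hm) fun y hy => ih y hy ?_ hlt
      rw [hρ, reads_succ_of_call hm]
    · exact hlast _ _ (by omega) hρ (call hm h)

/-- Among all sequences of moves that win on at least the same lengths, `m` minimizes the duration
of the longest play on the length `N`. -/
def Reduced (e : ℕ → Prop) (Y : Set ℕ) (D : ℕ) (m : ℕ → Bool) (N : ℕ) : Prop :=
  ∀ m', winSet e Y m ⊆ winSet e Y m' → ∀ T, Dead D m' N T → ∃ T' ≤ T, Dead D m N T'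

/-- In a reduced sequence of moves, no block from move `a` to move `b` can be replaced by a shorter
one, of length `l`, without losing wins or prolonging the longest play. -/
theorem Reduced.not_splice {D N a b l : ℕ} (hred : Reduced e Y D m N) (hN : ∃ T, Dead D m N T)
    (hlive : ∀ t < b, ¬ Dead D m N t) (hagree : ∀ i < a, m i = m' i) (hl : a + l < b)
    (hshift : ∀ i, m' (a + l + i) = m (b + i))
    (htail : ∀ r, 1 ≤ r → Win e Y m a (reads m a) r → Win e Y m' a (reads m a) r)
    (hle : D * calls m' (a + l) + reads m b ≤ D * calls m b + reads m' (a + l)) : False := by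
  classical
  have hsub : winSet e Y m ⊆ winSet e Y m' := fun n hn =>
    Win.of_prefix hagree htail hn rfl (Nat.zero_le a)
  let T := Nat.find hN
  have hT : Dead D m N T := Nat.find_spec hN
  have hbT : b ≤ T := by
    by_contra hlt
    exact hlive T (by omega) hT
  have hT' : Dead D m' N (a + l + (T - b)) := by
    have h1 := calls_shift hshift (T - b)
    have h2 := reads_shift hshift (T - b)
    rw [Nat.add_sub_cancel' hbT] at h1 h2
    unfold Dead at hT ⊢
    have h3 : D * calls m' (a + l + (T - b)) + D * calls m b =
        D * calls m T + D * calls m' (a + l) := by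
      rw [← mul_add, h1, mul_add]
    omega
  obtain ⟨T'', hle, hdead⟩ := hred m' hsub _ hT'
  exact Nat.find_min hN (m := T'') (by omega) hdead

/-- In a reduced sequence of moves, Romeo cannot restore both the number of remaining symbols and
the state of the target automaton by suitable replies: the block in between could be deleted. -/
theorem Reduced.not_return (he : ∀ k k', m₀ ≤ k → m₀ ≤ k' → k ≡ k' [MOD c] → (e k ↔ e k'))
    {D N a b : ℕ} (hD : ∀ y ∈ Y, y ≤ D) (hred : Reduced e Y D m N) (hN : ∃ T, Dead D m N T)
    (hlive : ∀ t < b, ¬ Dead D m N t) (hab : a < b) {p : ℕ → ℕ} (hp : IsPath Y m a b p)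
    (hpab : p b = p a) (hpge : ∀ i, a ≤ i → i ≤ b → p a ≤ p i) (ha : m₀ ≤ reads m a)
    (hmod : reads m a ≡ reads m b [MOD c]) : False := by
  let m' : ℕ → Bool := fun i => if i < a then m i else m (b + (i - a))
  have hagree : ∀ i < a, m i = m' i := fun i hi => by simp [m', hi]
  have hshift : ∀ i, m' (a + 0 + i) = m (b + i) := fun i => by simp [m']
  refine hred.not_splice (m' := m') (l := 0) hN hlive hagree hab hshift (fun r hr hw => ?_) ?_
  · have hp' : IsPath Y m a b fun i => p i - p a := by
      intro i hi hib
      obtain ⟨h1, h2⟩ := hp i hi hib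
      have h3 := hpge i hi (by omega)
      have h4 := hpge (i + 1) (by omega) (by omega)
      refine ⟨fun h => ?_, fun h => ?_⟩
      · obtain ⟨y, hy, heq⟩ := h1 h
        refine ⟨y, hy, ?_⟩
        beta_reduce
        omega
      · have := h2 h
        beta_reduce
        omega
    have hwb := Win.along_path (κ := 0) hp' hab.le hr (by simpa using hw)
    simp only [hpab, Nat.sub_self, add_zero, zero_add] at hwb
    refine (hwb.congr_modEq he (ha.trans (reads_mono m hab.le)) ha hmod.symm).congr_tail fun i => ?_
    have := hshift i
    rw [add_zero] at this
    exact this.symm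
  · have := hp.le hD hab.le
    rw [add_zero, ← calls_congr hagree, ← reads_congr hagree]
    omega

/-- In a reduced sequence of moves, there is no long block during which the number of remaining
symbols does not fall below its initial value, even if Romeo always gives his shortest reply `d`.
For the calls of such a block may be made right at its beginning, and then `c` of them can be saved
together with the `c * d` reads of the replies to them. -/
theorem Reduced.not_block (he : ∀ k k', m₀ ≤ k → m₀ ≤ k' → k ≡ k' [MOD c] → (e k ↔ e k'))
    {d D N a b : ℕ} (hc : 1 ≤ c) (hd : 1 ≤ d) (hdY : d ∈ Y) (hdmin : ∀ y ∈ Y, d ≤ y) (hdD : d ≤ D)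
    (hred : Reduced e Y D m N) (hN : ∃ T, Dead D m N T)
    (hlive : ∀ t < b, ¬ Dead D m N t) (hab : a ≤ b)
    (hlevel : ∀ i, a ≤ i → i ≤ b → reads m i + d * calls m a ≤ reads m a + d * calls m i)
    (hlong : reads m a + m₀ + c * d ≤ reads m b) : False := by
  obtain ⟨J, hJ⟩ : ∃ J, calls m b = calls m a + J :=
    ⟨_, (Nat.add_sub_cancel' (calls_mono m hab)).symm⟩
  obtain ⟨R, hR⟩ : ∃ R, reads m b = reads m a + R + c * d :=
    ⟨reads m b - reads m a - c * d, by omega⟩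
  have hJR : R + c * d ≤ d * J := by
    have := hlevel b hab le_rfl
    rw [hJ, mul_add] at this
    omega
  have hcJ : c ≤ J := by
    have : d * c ≤ d * J := by rw [mul_comm d c]; omega
    exact Nat.le_of_mul_le_mul_left this hd
  obtain ⟨K, rfl⟩ : ∃ K, J = K + c := ⟨J - c, by omega⟩
  let m' : ℕ → Bool := fun i =>
    if i < a then m i else if i < a + K then true else if i < a + (K + R) then false
    else m (b + (i - (a + (K + R))))
  have hagree : ∀ i < a, m i = m' i := fun i hi => by simp [m', hi]
  have hcall : ∀ i < K, m' (a + i) = true := fun i hi => by simp [m', hi]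
  have hread : ∀ i < R, m' (a + K + i) = false := fun i hi => by
    simp only [m']
    rw [if_neg (by omega), if_neg (by omega), if_pos (by omega)]
  have hshift : ∀ i, m' (a + (K + R) + i) = m (b + i) := fun i => by
    simp only [m']
    rw [if_neg (by omega), if_neg (by omega), if_neg (by omega)]
    congr 2
    omega
  have hlen : a + (K + R) < b := by
    have h1 := calls_add_reads m a
    have h2 := calls_add_reads m b
    omega
  refine hred.not_splice (m' := m') hN hlive hagree hlen hshift (fun r hr hw => ?_) ?_
  · refine Win.of_calls hr hcall (fun y hy => ?_) ⟨d, hdY⟩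
    let z : ℕ → ℕ := fun k => if k < K then y k else d
    have hzY : ∀ k, z k ∈ Y := fun k => by
      by_cases h : k < K
      · simp only [z, if_pos h]; exact hy k
      · simp only [z, if_neg h]; exact hdY
    have hzd : ∀ k, d ≤ z k := fun k => hdmin _ (hzY k)
    let s : ℕ → ℕ := fun i => ∑ k ∈ Finset.range (calls m i - calls m a), z k
    have hs : ∀ i, a ≤ i → i ≤ b → reads m i ≤ reads m a + s i := by
      intro i hai hib
      have h1 := hlevel i hai hib
      have h2 := calls_mono m hai
      have h3 : d * (calls m i - calls m a) ≤ s i := by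
        calc d * (calls m i - calls m a)
            = ∑ k ∈ Finset.range (calls m i - calls m a), d := by simp [mul_comm]
          _ ≤ _ := Finset.sum_le_sum fun k _ => hzd k
      rw [Nat.mul_sub] at h3
      omega
    have hp : IsPath Y m a b fun i => s i + reads m a - reads m i := by
      intro i hi hib
      have h1 := hs i hi hib.le
      have h2 := hs (i + 1) (by omega) hib
      refine ⟨fun h => ⟨z (calls m i - calls m a), hzY _, ?_⟩, fun h => ?_⟩
      · have hsi : s (i + 1) = s i + z (calls m i - calls m a) := by
          have := calls_mono m hi
          simp only [s]
          rw [calls_succ_of_call h, Nat.sub_add_comm this, Finset.sum_range_succ]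
        beta_reduce
        rw [hsi, reads_succ_of_call h]
        omega
      · have hsi : s (i + 1) = s i := by simp only [s, calls_succ_of_read h]
        beta_reduce
        rw [hsi, reads_succ_of_read h] at h2 ⊢
        omega
    have hsa : s a = 0 := by simp [s]
    have hsb : s b = ∑ i ∈ Finset.range K, y i + c * d := by
      simp only [s, hJ, Nat.add_sub_cancel_left]
      rw [Finset.sum_range_add]
      congr 1
      · exact Finset.sum_congr rfl fun k hk => if_pos (Finset.mem_range.1 hk)
      · rw [Finset.sum_congr rfl fun k _ => if_neg (by omega : ¬ K + k < K)]
        simp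
    have hwb := Win.along_path (κ := 0) hp hab hr (by simpa [hsa] using hw)
    have hsum := hs b hab le_rfl
    simp only [hsb, zero_add] at hwb hsum
    obtain ⟨q, hq⟩ : ∃ q, r + ∑ i ∈ Finset.range K, y i = q + R :=
      ⟨r + ∑ i ∈ Finset.range K, y i - R, by omega⟩
    rw [hq, Win.reads_iff hread, add_assoc a]
    rw [show r + (∑ i ∈ Finset.range K, y i + c * d + reads m a - reads m b) = q by omega] at hwb
    refine (hwb.congr_modEq he (by omega) (by omega) ?_).congr_tail fun i => (hshift i).symm
    rw [hR]
    exact (Nat.modEq_iff_dvd' (by omega)).2 ⟨d, by omega⟩ |>.symm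
  · have hca : calls m' (a + (K + R)) = calls m a + K := by
      have h1 : ∀ i ≤ K, calls m' (a + i) = calls m a + i := by
        intro i
        induction i with
        | zero => intro _; exact (calls_congr hagree).symm
        | succ i ih =>
          intro hi
          rw [← add_assoc, calls_succ_of_call (hcall i hi), ih (by omega), add_assoc]
      have h2 : ∀ i ≤ R, calls m' (a + K + i) = calls m a + K := by
        intro i
        induction i with
        | zero => intro _; exact h1 K le_rfl
        | succ i ih =>
          intro hi
          rw [← add_assoc, calls_succ_of_read (hread i hi), ih (by omega)]
      rw [← add_assoc]
      exact h2 R le_rfl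
    have hra : reads m' (a + (K + R)) = reads m a + R := by
      have h1 := calls_add_reads m' (a + (K + R))
      have h2 := calls_add_reads m a
      omega
    have : c * d ≤ D * c := by rw [mul_comm c d]; exact Nat.mul_le_mul_right c hdD
    rw [hca, hra, hJ, hR, mul_add, mul_add, mul_add]
    omega

/-- In a reduced sequence of moves, the number of remaining symbols cannot rise much when Romeo
always gives his shortest reply `d`. -/
theorem Reduced.not_rise (he : ∀ k k', m₀ ≤ k → m₀ ≤ k' → k ≡ k' [MOD c] → (e k ↔ e k'))
    {d D N a s : ℕ} (hc : 1 ≤ c) (hd : 1 ≤ d) (hdY : d ∈ Y) (hdmin : ∀ y ∈ Y, d ≤ y) (hdD : d ≤ D)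
    (hred : Reduced e Y D m N) (hN : ∃ T, Dead D m N T)
    (hlive : ∀ t ≤ s, ¬ Dead D m N t) (has : a ≤ s)
    (hlevel : ∀ i, a ≤ i → i ≤ s → reads m i + d * calls m a ≤ reads m a + d * calls m i)
    (hrise : reads m s + d * calls m a + (m₀ + c * d) ≤ reads m a + d * calls m s) : False := by
  classical
  let T := Nat.find hN
  have hT : Dead D m N T := Nat.find_spec hN
  have hsT : s < T := by
    by_contra hlt
    exact hlive T (by omega) hT
  have hla := hlive a has
  have hcd : 1 ≤ c * d := Nat.mul_pos hc hd
  unfold Dead at hT hla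
  have hTlong : reads m a + m₀ + c * d ≤ reads m T := by
    obtain ⟨J, hJ⟩ : ∃ J, calls m s = calls m a + J :=
      ⟨_, (Nat.add_sub_cancel' (calls_mono m has)).symm⟩
    have h1 : D * calls m s ≤ D * calls m T := Nat.mul_le_mul_left _ (calls_mono m hsT.le)
    have h2 : d * J ≤ D * J := Nat.mul_le_mul_right _ hdD
    have h3 := reads_mono m has
    rw [hJ, mul_add] at h1 hrise
    omega
  have hex : ∃ b, reads m a + m₀ + c * d ≤ reads m b := ⟨T, hTlong⟩
  have hbT : Nat.find hex ≤ T := Nat.find_min' hex hTlong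
  have hb := Nat.find_spec hex
  have hab : a ≤ Nat.find hex := by
    by_contra hlt
    have := reads_mono m (not_le.1 hlt).le
    omega
  refine hred.not_block he hc hd hdY hdmin hdD hN (b := Nat.find hex)
    (fun t ht => Nat.find_min hN (by omega)) hab (fun i hai hib => ?_) hb
  rcases le_or_gt i s with his | his
  · exact hlevel i hai his
  · have h1 : reads m i ≤ reads m a + m₀ + c * d := by
      obtain ⟨j, rfl⟩ : ∃ j, i = j + 1 := ⟨i - 1, by omega⟩
      have := Nat.find_min hex (m := j) (by omega)
      have h3 : reads m (j + 1) ≤ reads m j + 1 := by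
        simp only [reads]
        split_ifs <;> omega
      omega
    have h2 : d * calls m s ≤ d * calls m i := Nat.mul_le_mul_left _ (calls_mono m his.le)
    have h3 := reads_mono m has
    omega

/-! ### Infinite plays with few remaining symbols -/

/-- After `t` moves, with `r` symbols remaining, the play in which Romeo always gives his longest
reply `D` is infinite. -/
def Immortal (D : ℕ) (m : ℕ → Bool) (t r : ℕ) : Prop :=
  ∀ s, t ≤ s → reads m s + D * calls m t < r + D * calls m s + reads m t

open Classical in
/-- The number of remaining symbols in the play on the input length `n` in which Romeo gives his
shortest reply `d` unless this would prevent an infinite play, and his longest reply `D` then. -/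
noncomputable def thriftyPath (d D : ℕ) (m : ℕ → Bool) (n : ℕ) : ℕ → ℕ
  | 0 => n
  | t + 1 =>
    if m t then
      if Immortal D m (t + 1) (thriftyPath d D m n t + d) then thriftyPath d D m n t + d
      else thriftyPath d D m n t + D
    else thriftyPath d D m n t - 1

theorem thriftyPath_succ_of_read {d D n t : ℕ} (h : m t = false) :
    thriftyPath d D m n (t + 1) = thriftyPath d D m n t - 1 := by
  simp [thriftyPath, h]

theorem thriftyPath_succ_of_immortal {d D n t : ℕ} (h : m t = true)
    (hi : Immortal D m (t + 1) (thriftyPath d D m n t + d)) :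
    thriftyPath d D m n (t + 1) = thriftyPath d D m n t + d := by
  simp [thriftyPath, h, hi]

theorem thriftyPath_succ_of_not_immortal {d D n t : ℕ} (h : m t = true)
    (hi : ¬ Immortal D m (t + 1) (thriftyPath d D m n t + d)) :
    thriftyPath d D m n (t + 1) = thriftyPath d D m n t + D := by
  simp [thriftyPath, h, hi]

theorem immortal_thriftyPath {d D n : ℕ} (hlive : ∀ t, ¬ Dead D m n t) (t : ℕ) :
    Immortal D m t (thriftyPath d D m n t) := by
  induction t with
  | zero =>
    intro s _
    have := hlive s
    unfold Dead at this
    simp only [calls, reads, thriftyPath]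
    omega
  | succ t ih =>
    cases h : m t
    · intro s hs
      have h1 := ih s (by omega)
      have h2 := ih t le_rfl
      rw [thriftyPath_succ_of_read h, calls_succ_of_read h, reads_succ_of_read h]
      omega
    · by_cases hi : Immortal D m (t + 1) (thriftyPath d D m n t + d)
      · rw [thriftyPath_succ_of_immortal h hi]
        exact hi
      · intro s hs
        have h1 := ih s (by omega)
        rw [thriftyPath_succ_of_not_immortal h hi, calls_succ_of_call h, reads_succ_of_call h,
          mul_add]
        omega

theorem thriftyPath_pos {d D n : ℕ} (hlive : ∀ t, ¬ Dead D m n t) (t : ℕ) :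
    1 ≤ thriftyPath d D m n t := by
  have := immortal_thriftyPath (d := d) hlive t t le_rfl
  omega

theorem isPath_thriftyPath {d D n : ℕ} (hd : d ∈ Y) (hD : D ∈ Y) (hlive : ∀ t, ¬ Dead D m n t)
    (a b : ℕ) : IsPath Y m a b (thriftyPath d D m n) := by
  intro t _ _
  have hpos := thriftyPath_pos (d := d) hlive t
  refine ⟨fun h => ?_, fun h => ?_⟩
  · by_cases hi : Immortal D m (t + 1) (thriftyPath d D m n t + d)
    · exact ⟨d, hd, thriftyPath_succ_of_immortal h hi⟩
    · exact ⟨D, hD, thriftyPath_succ_of_not_immortal h hi⟩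
  · rw [thriftyPath_succ_of_read h]
    omega

/-- The thrifty play returns to a bounded number of remaining symbols again and again. If Romeo has
to give his longest reply infinitely often, then the play nearly ends each time. Otherwise he
eventually always gives his shortest reply, and then the numbers cannot rise much. -/
theorem frequently_thriftyPath_le {d D n : ℕ} (hdY : d ∈ Y) (hDY : D ∈ Y)
    (hDmax : ∀ y ∈ Y, y ≤ D) (hlive : ∀ t, ¬ Dead D m n t) {H : ℕ}
    (hrise : ∀ a s, a ≤ s →
      (∀ i, a ≤ i → i ≤ s → reads m i + d * calls m a ≤ reads m a + d * calls m i) →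
      ¬ reads m s + d * calls m a + H ≤ reads m a + d * calls m s) :
    ∃ K, ∀ t₀, ∃ t, t₀ ≤ t ∧ thriftyPath d D m n t ≤ K := by
  let p := thriftyPath d D m n
  by_cases hd : ∃ t₁, ∀ t, t₁ ≤ t → m t = true → Immortal D m (t + 1) (p t + d)
  · obtain ⟨t₁, ht₁⟩ := hd
    obtain ⟨a, ha, hmin⟩ := (measure p).wf.has_min (Set.Ici t₁) ⟨t₁, Set.mem_Ici.2 le_rfl⟩
    have hle : ∀ i, a ≤ i → p a ≤ p i := fun i hi => not_lt.1 (hmin i (le_trans ha hi))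
    have heq : ∀ i, a ≤ i → p i + reads m i + d * calls m a = p a + reads m a + d * calls m i := by
      intro i hi
      induction i, hi using Nat.le_induction with
      | base => omega
      | succ i hai ih =>
        have hpos : 1 ≤ p i := thriftyPath_pos hlive i
        cases h : m i
        · rw [calls_succ_of_read h, reads_succ_of_read h,
            show p (i + 1) = p i - 1 from thriftyPath_succ_of_read h]
          omega
        · rw [calls_succ_of_call h, reads_succ_of_call h, show p (i + 1) = p i + d from
            thriftyPath_succ_of_immortal h (ht₁ i (le_trans ha hai) h), mul_add]
          omega
    refine ⟨p a + H, fun t₀ => ?_⟩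
    by_contra! hc
    have hs : p a + H < p (max t₀ a) := hc (max t₀ a) (le_max_left _ _)
    have has : a ≤ max t₀ a := le_max_right _ _
    have h1 := heq _ has
    refine hrise a _ has (fun i hai _ => ?_) (by omega)
    have h2 := heq i hai
    have h3 := hle i hai
    omega
  · push Not at hd
    refine ⟨D, fun t₀ => ?_⟩
    obtain ⟨t, ht, hm, hi⟩ := hd t₀
    have hp : p (t + 1) = p t + D := thriftyPath_succ_of_not_immortal hm hi
    unfold Immortal at hi
    push Not at hi
    obtain ⟨s, hs, hle⟩ := hi
    have h1 := (isPath_thriftyPath hdY hDY hlive (t + 1) s).le hDmax hs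
    refine ⟨s, by omega, ?_⟩
    change p s + _ + _ ≤ p (t + 1) + _ + _ at h1
    change p s ≤ D
    omega

/-- If the longest play on some length `n` in `m` is infinite, then not every initial part of `m` is
part of a reduced sequence in which the longest play lasts longer than that part. -/
theorem not_forall_reduced_prefix (he : ∀ k k', m₀ ≤ k → m₀ ≤ k' → k ≡ k' [MOD c] → (e k ↔ e k'))
    {d D n : ℕ} (hc : 1 ≤ c) (hd : 1 ≤ d) (hdY : d ∈ Y) (hDY : D ∈ Y) (hdmin : ∀ y ∈ Y, d ≤ y)
    (hDmax : ∀ y ∈ Y, y ≤ D) (hlive : ∀ t, ¬ Dead D m n t) :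
    ¬ ∀ b, ∃ m' N, (∀ i < b, m i = m' i) ∧ Reduced e Y D m' N ∧ (∃ T, Dead D m' N T) ∧
      ∀ t ≤ b, ¬ Dead D m' N t := by
  classical
  intro happrox
  let p := thriftyPath d D m n
  obtain ⟨K, hK⟩ : ∃ K, ∀ t₀, ∃ t, t₀ ≤ t ∧ p t ≤ K := by
    refine frequently_thriftyPath_le hdY hDY hDmax hlive (H := m₀ + c * d) fun a s has hlev hr => ?_
    obtain ⟨m', N, hagree, hred, hN, hl⟩ := happrox s
    have hcalls : ∀ i ≤ s, calls m i = calls m' i := fun i hi =>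
      calls_congr fun j hj => hagree j (by omega)
    have hreads : ∀ i ≤ s, reads m i = reads m' i := fun i hi =>
      reads_congr fun j hj => hagree j (by omega)
    refine hred.not_rise he hc hd hdY hdmin (hDmax d hdY) hN hl has (fun i hai his => ?_) ?_
    · rw [← hcalls a has, ← hcalls i his, ← hreads a has, ← hreads i his]
      exact hlev i hai his
    · rw [← hcalls a has, ← hcalls s le_rfl, ← hreads a has, ← hreads s le_rfl]
      exact hr
  -- The least number that bounds the remaining symbols infinitely often is attained infinitely
  -- often.
  have hex : ∃ K, ∀ t₀, ∃ t, t₀ ≤ t ∧ p t ≤ K := ⟨K, hK⟩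
  let l := Nat.find hex
  have hl : ∀ t₀, ∃ t, t₀ ≤ t ∧ p t ≤ l := Nat.find_spec hex
  obtain ⟨T, hT⟩ : ∃ T, ∀ t, T ≤ t → l ≤ p t := by
    rcases Nat.eq_zero_or_pos l with h0 | hpos
    · exact ⟨0, fun t _ => by omega⟩
    · have := Nat.find_min hex (m := l - 1) (by omega)
      push Not at this
      obtain ⟨T, hT⟩ := this
      exact ⟨T, fun t ht => by have := hT t ht; omega⟩
  let S : Set ℕ := {t | T ≤ t ∧ l + 2 * m₀ ≤ t ∧ p t = l}
  have hS : S.Infinite := by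
    refine Set.infinite_of_forall_exists_gt fun t₀ => ?_
    obtain ⟨t, ht, hle⟩ := hl (max (t₀ + 1) (max T (l + 2 * m₀)))
    simp only [max_le_iff] at ht
    exact ⟨t, ⟨ht.2.1, ht.2.2, le_antisymm hle (hT t ht.2.1)⟩, by omega⟩
  obtain ⟨a, haS, b, hbS, hab, hmod⟩ : ∃ a ∈ S, ∃ b ∈ S, a < b ∧ reads m a ≡ reads m b [MOD c] := by
    obtain ⟨a, ha, b, hb, hne, heq⟩ := hS.exists_ne_map_eq_of_mapsTo (f := fun t => reads m t % c)
      (t := Set.Iio c) (fun t _ => Nat.mod_lt _ hc) (Set.finite_Iio c)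
    rcases lt_or_gt_of_ne hne with h | h
    · exact ⟨a, ha, b, hb, h, heq⟩
    · exact ⟨b, hb, a, ha, h, heq.symm⟩
  have hreads : m₀ ≤ reads m a := by
    have h1 := (isPath_thriftyPath hdY hDY hlive 0 a).ge hdmin (Nat.zero_le a)
    have h2 := calls_add_reads m a
    have h3 : 1 * calls m a ≤ d * calls m a := Nat.mul_le_mul_right _ hd
    have h4 := haS.2.1
    have h5 : p a = l := haS.2.2
    change p 0 + _ + _ ≤ p a + _ + _ at h1
    simp only [calls, reads] at h1
    omega
  obtain ⟨m', N, hagree, hred, hN, hlv⟩ := happrox b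
  have ha' : reads m a = reads m' a := reads_congr fun j hj => hagree j (by omega)
  have hb' : reads m b = reads m' b := reads_congr fun j hj => hagree j hj
  refine hred.not_return he hDmax hN (fun t ht => hlv t ht.le) hab
    ((isPath_thriftyPath hdY hDY hlive a b).congr hagree) ?_ (fun i hi _ => ?_) (ha' ▸ hreads)
    (by rwa [← ha', ← hb'])
  · exact hbS.2.2.trans haS.2.2.symm
  · change p a ≤ p i
    rw [haS.2.2]
    exact hT i (haS.1.trans hi)

theorem exists_reduced {D N : ℕ} (hDY : D ∈ Y) (hN : N ∈ winSet e Y m) :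
    ∃ m', winSet e Y m ⊆ winSet e Y m' ∧ Reduced e Y D m' N := by
  classical
  have hex : ∃ T m', winSet e Y m ⊆ winSet e Y m' ∧ Dead D m' N T := by
    obtain ⟨T, -, hT⟩ := Win.exists_dead hDY hN
    exact ⟨T, m, le_rfl, by simpa [calls, reads, Dead] using hT⟩
  obtain ⟨m', hsub, hdead⟩ := Nat.find_spec hex
  exact ⟨m', hsub, fun m'' hsub' T hT =>
    ⟨_, Nat.find_min' hex ⟨m'', hsub.trans hsub', hT⟩, hdead⟩⟩

/-- Reduced sequences of moves that approximate the greedy supremum of the winning sets have a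
limit, in which the longest play on each length in the supremum is finite. -/
theorem exists_maximal_of_finite (he : ∀ k k', m₀ ≤ k → m₀ ≤ k' → k ≡ k' [MOD c] → (e k ↔ e k'))
    (hc : 1 ≤ c) (hfin : Y.Finite) (hne : Y.Nonempty) (hpos : 0 ∉ Y) :
    ∃ m, ∀ m', winSet e Y m ⊆ winSet e Y m' → winSet e Y m = winSet e Y m' := by
  classical
  obtain ⟨d, hdY, hdmin⟩ := Set.exists_min_image Y id hfin hne
  obtain ⟨D, hDY, hDmax⟩ := Set.exists_max_image Y id hfin hne
  simp only [id] at hdmin hDmax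
  have hd : 1 ≤ d := Nat.one_le_iff_ne_zero.2 fun h => hpos (h ▸ hdY)
  obtain ⟨V, hV, happrox⟩ := FirstDiffLE.exists_greedy (f := (id : ℕ → ℕ)) Function.injective_id
    (Set.range (winSet e Y)) (Set.range_nonempty _)
  -- A winning set that contains the greedy supremum is equal to it.
  suffices h : ∃ m, V ⊆ winSet e Y m by
    obtain ⟨m, hm⟩ := h
    have key : ∀ m', V ⊆ winSet e Y m' → winSet e Y m' = V := fun m' hm' =>
      (hV _ ⟨m', rfl⟩).eq_of_superset hm'
    exact ⟨m, fun m' h => (key m hm).trans (key m' (hm.trans h)).symm⟩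
  have hk : ∀ k, ∃ m N, (∀ n ∈ V, n ≤ k → n ∈ winSet e Y m ∧ n ≤ N) ∧
      ((∃ n ∈ V, n ≤ k) → Reduced e Y D m N ∧ ∃ T, Dead D m N T) := by
    intro k
    obtain ⟨_, ⟨m, rfl⟩, hm⟩ := happrox (k + 1)
    by_cases hex : ∃ n ∈ V, n ≤ k
    · obtain ⟨n, hn, hnk⟩ := hex
      have hNV : Nat.findGreatest (· ∈ V) k ∈ V := Nat.findGreatest_spec hnk hn
      have hNk : Nat.findGreatest (· ∈ V) k ≤ k := Nat.findGreatest_le k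
      obtain ⟨m', hsub, hred⟩ := exists_reduced hDY
        ((hm (Nat.findGreatest (· ∈ V) k) (by simp only [id]; omega)).2 hNV)
      have hwin : ∀ n ∈ V, n ≤ k → n ∈ winSet e Y m' := fun n hn hnk =>
        hsub ((hm n (by simp only [id]; omega)).2 hn)
      refine ⟨m', _, fun n hn hnk => ⟨hwin n hn hnk, Nat.le_findGreatest hnk hn⟩,
        fun _ => ⟨hred, ?_⟩⟩
      obtain ⟨T, -, hT⟩ := Win.exists_dead hDY (hwin _ hNV hNk)
      exact ⟨T, by simpa [calls, reads, Dead] using hT⟩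
    · exact ⟨m, 0, fun n hn hnk => absurd ⟨n, hn, hnk⟩ hex, fun h => absurd h hex⟩
  choose s N hs hred using hk
  choose m hm using fun t => (Filter.hyperfilter ℕ).exists_eventually_eq fun k => s k t
  have hlim : ∀ n b, ∃ k, n ≤ k ∧ ∀ i < b, m i = s k i := by
    intro n b
    have h1 : ∀ᶠ k in (Filter.hyperfilter ℕ : Filter ℕ), n ≤ k := by
      refine Filter.Eventually.filter_mono Filter.hyperfilter_le_cofinite ?_
      rw [Nat.cofinite_eq_atTop]
      exact Filter.eventually_ge_atTop n
    have h2 : ∀ᶠ k in (Filter.hyperfilter ℕ : Filter ℕ), ∀ i ∈ Set.Iio b, s k i = m i :=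
      (Filter.eventually_all_finite (Set.finite_Iio b)).2 fun i _ => hm i
    obtain ⟨k, hk1, hk2⟩ := (h1.and h2).exists
    exact ⟨k, hk1, fun i hi => (hk2 i hi).symm⟩
  refine ⟨m, fun n hn => ?_⟩
  obtain ⟨T, hT⟩ : ∃ T, Dead D m n T := by
    by_contra! hlive
    refine not_forall_reduced_prefix he hc hd hdY hDY hdmin hDmax hlive fun b => ?_
    obtain ⟨k, hnk, hagree⟩ := hlim n b
    obtain ⟨hr, hT⟩ := hred k ⟨n, hn, hnk⟩
    refine ⟨s k, N k, hagree, hr, hT, fun t ht hdead => hlive t ?_⟩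
    have h1 := (hs k n hn hnk).2
    have h2 := calls_congr (t := t) fun i hi => hagree i (by omega)
    have h3 := reads_congr (t := t) fun i hi => hagree i (by omega)
    unfold Dead at hdead ⊢
    rw [h2, h3]
    omega
  obtain ⟨k, hnk, hagree⟩ := hlim n T
  exact Win.of_agree hDmax hagree (hs k n hn hnk).1 (Nat.zero_le T)
    (by simpa [calls, reads, Dead] using hT)

/-- For an eventually periodic target, some sequence of moves has a maximal winning set. -/
theorem exists_maximal (he : ∀ k k', m₀ ≤ k → m₀ ≤ k' → k ≡ k' [MOD c] → (e k ↔ e k'))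
    (hc : 1 ≤ c) (hne : Y.Nonempty) :
    ∃ m, ∀ m', winSet e Y m ⊆ winSet e Y m' → winSet e Y m = winSet e Y m' := by
  by_cases h0 : 0 ∈ Y
  · exact exists_maximal_of_zero_mem h0
  by_cases hfin : Y.Finite
  · exact exists_maximal_of_finite he hc hfin hne h0
  obtain ⟨y, hy⟩ := hne
  obtain ⟨y', hy', hyy⟩ := Set.Infinite.exists_gt (s := Y) hfin (y + c)
  exact exists_maximal_of_add_le hc
    (fun k hk => he _ _ (by omega) hk (by simp [Nat.ModEq])) hy hy' hyy.le

end UnaryGame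

namespace Game

variable {A : Type u} {Q : Type v} {G : Game A Q}

/-! ### Unary games and sequences of moves -/

open Classical in
/-- The history after the first `t` moves in a unary game. -/
noncomputable def unaryHistory (σ : G.Strategy) (a : G.FunSym) : ℕ → List G.Hist
  | 0 => []
  | t + 1 => unaryHistory σ a t ++
      [if σ (unaryHistory σ a t) a = Move.call then Sum.inr a else Sum.inl a.1]

open Classical in
/-- The sequence of moves that a strategy plays in a unary game. -/
noncomputable def unaryMoves (σ : G.Strategy) (a : G.FunSym) (t : ℕ) : Bool :=
  decide (σ (unaryHistory σ a t) a = Move.call)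

/-- Romeo's set `Y` consists of the amounts by which the replies prolong the remaining string. -/
theorem ends_iff_win {a : G.FunSym} (ha : ∀ b : A, b = a.1) {e : ℕ → Prop} {σ : G.Strategy}
    {q : ℕ → Q} (hq : ∀ ρ, q (ρ + 1) = G.T.step (q ρ) a.1) (he : ∀ ρ, e ρ ↔ q ρ ∈ G.T.accept)
    {t ρ : ℕ} {w : List A} :
    Ends σ G.T.accept (unaryHistory σ a t) (q ρ) w ↔
      UnaryGame.Win e {y | ∃ x ∈ G.L a.1, x.length = y + 1} (unaryMoves σ a) t ρ w.length := by
  have hcall : ∀ t, unaryMoves σ a t = true →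
      called σ (unaryHistory σ a t) a.1 = some a ∧
        unaryHistory σ a (t + 1) = unaryHistory σ a t ++ [Sum.inr a] := by
    intro t h
    have h' : σ (unaryHistory σ a t) a = Move.call := by simpa [unaryMoves] using h
    exact ⟨called_eq_some.2 ⟨rfl, h'⟩, by simp [unaryHistory, h']⟩
  have hread : ∀ t, unaryMoves σ a t = false →
      called σ (unaryHistory σ a t) a.1 = none ∧
        unaryHistory σ a (t + 1) = unaryHistory σ a t ++ [Sum.inl a.1] := by
    intro t h
    have h' : σ (unaryHistory σ a t) a ≠ Move.call := by simpa [unaryMoves] using h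
    refine ⟨called_eq_none.2 fun _ => ?_, by simp [unaryHistory, h']⟩
    cases hm : σ (unaryHistory σ a t) a
    · rfl
    · exact absurd hm h'
  constructor
  · generalize hα : unaryHistory σ a t = α
    generalize hq' : q ρ = q'
    intro h
    induction h generalizing t ρ with
    | nil h =>
      subst hq'
      exact UnaryGame.Win.nil ((he _).2 h)
    | @read α q' b v hc _ ih =>
      subst hα hq'
      obtain rfl := ha b
      cases hm : unaryMoves σ a t
      · exact UnaryGame.Win.read hm (ih (hread t hm).2 (hq ρ))
      · rw [(hcall t hm).1] at hc
        cases hc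
    | @call α q' b v b' hc _ ih =>
      subst hα hq'
      obtain rfl := ha b
      cases hm : unaryMoves σ a t
      · rw [(hread t hm).1] at hc
        cases hc
      · rw [(hcall t hm).1] at hc
        cases hc
        refine UnaryGame.Win.call hm ?_
        rintro y ⟨x, hx, hxy⟩
        have := ih x hx (hcall t hm).2 rfl
        rw [List.length_append, hxy] at this
        rw [show v.length + 1 + y = y + 1 + v.length by omega]
        exact this
  · generalize hr : w.length = r
    intro h
    induction h generalizing w with
    | nil h =>
      obtain rfl := List.length_eq_zero_iff.1 hr
      exact Ends.nil ((he _).1 h)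
    | @read t ρ r hm _ ih =>
      cases w with
      | nil => cases hr
      | cons b v =>
        obtain rfl := ha b
        refine Ends.read (hread t hm).1 ?_
        rw [← (hread t hm).2, ← hq]
        exact ih (by simpa using hr)
    | @call t ρ r hm _ ih =>
      cases w with
      | nil => cases hr
      | cons b v =>
        obtain rfl := ha b
        refine Ends.call (hcall t hm).1 fun x hx => ?_
        rw [← (hcall t hm).2]
        have hpos := List.length_pos_of_ne_nil (G.ne_nil _ _ hx)
        refine ih (x.length - 1) ⟨x, hx, by omega⟩ ?_
        simp only [List.length_cons, add_left_inj] at hr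
        rw [List.length_append]
        omega

theorem unaryMoves_of_length {a : G.FunSym} (m : ℕ → Bool) :
    unaryMoves (fun α _ => if m α.length then Move.call else Move.read) a = m := by
  have hlen : ∀ (σ : G.Strategy) t, (unaryHistory σ a t).length = t := by
    intro σ t
    induction t with
    | zero => rfl
    | succ t ih => simp [unaryHistory, ih]
  funext t
  have h := hlen (fun α _ => if m α.length then Move.call else Move.read) t
  unfold unaryMoves
  generalize unaryHistory (G := G) (fun α _ => if m α.length then Move.call else Move.read) a t = α
    at h ⊢
  subst h
  cases hm : m α.length <;> simp [hm]

theorem exists_undominated_of_unary (hG : G.Unary) : ∃ σ : G.Strategy, Undominated σ := by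
  have := G.finite_states
  obtain ⟨hsub, ⟨a⟩⟩ := Nat.card_eq_one_iff_unique.1 (show Nat.card A = 1 from hG)
  by_cases hf : G.IsFun a
  · -- The states of the target automaton are eventually periodic.
    let q : ℕ → Q := fun ρ => (fun q => G.T.step q a)^[ρ] G.T.start
    have hq : ∀ ρ, q (ρ + 1) = G.T.step (q ρ) a := fun ρ => Function.iterate_succ_apply' _ _ _
    obtain ⟨m₀, c, hc, hper⟩ : ∃ m₀ c, 1 ≤ c ∧ q (m₀ + c) = q m₀ := by
      obtain ⟨i, j, hne, heq⟩ := Finite.exists_ne_map_eq_of_infinite q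
      rcases lt_or_gt_of_ne hne with h | h
      · exact ⟨i, j - i, by omega, by rw [Nat.add_sub_cancel' h.le]; exact heq.symm⟩
      · exact ⟨j, i - j, by omega, by rw [Nat.add_sub_cancel' h.le]; exact heq⟩
    have hper' : ∀ k, m₀ ≤ k → q (k + c) = q k := by
      intro k hk
      induction k, hk using Nat.le_induction with
      | base => exact hper
      | succ k _ ih => rw [add_right_comm, hq, hq, ih]
    have hmul : ∀ k z, m₀ ≤ k → q (k + c * z) = q k := by
      intro k z hk
      induction z with
      | zero => rfl
      | succ z ih => rw [mul_add, mul_one, ← add_assoc, hper' _ (by omega), ih]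
    have he : ∀ k k', m₀ ≤ k → m₀ ≤ k' → k ≡ k' [MOD c] →
        (q k ∈ G.T.accept ↔ q k' ∈ G.T.accept) := by
      have key : ∀ k k', m₀ ≤ k → k ≤ k' → k ≡ k' [MOD c] → q k = q k' := by
        intro k k' hk hkk' hmod
        obtain ⟨z, hz⟩ := (Nat.modEq_iff_dvd' hkk').1 hmod
        rw [show k' = k + c * z by omega, hmul k z hk]
      intro k k' hk hk' hmod
      rcases le_total k k' with h | h
      · rw [key k k' hk h hmod]
      · rw [key k' k hk' h hmod.symm]
    have hlink : ∀ (σ : G.Strategy) (w : List A), w ∈ W σ ↔ w.length ∈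
        UnaryGame.winSet (fun ρ => q ρ ∈ G.T.accept) {y | ∃ x ∈ G.L a, x.length = y + 1}
          (unaryMoves σ ⟨a, hf⟩) := by
      intro σ w
      rw [mem_W_iff]
      exact ends_iff_win (a := ⟨a, hf⟩) (t := 0) (ρ := 0) (fun b => Subsingleton.elim _ _) hq
        fun _ => Iff.rfl
    obtain ⟨m, hm⟩ := UnaryGame.exists_maximal (Y := {y | ∃ x ∈ G.L a, x.length = y + 1}) he hc (by
      obtain ⟨x, hx⟩ := hf
      have := List.length_pos_of_ne_nil (G.ne_nil _ _ hx)
      exact ⟨x.length - 1, x, hx, by omega⟩)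
    refine ⟨fun α _ => if m α.length then Move.call else Move.read, ?_⟩
    rintro ⟨σ', hdom, hne⟩
    have hsub' : UnaryGame.winSet (fun ρ => q ρ ∈ G.T.accept)
        {y | ∃ x ∈ G.L a, x.length = y + 1} m ⊆ UnaryGame.winSet (fun ρ => q ρ ∈ G.T.accept)
          {y | ∃ x ∈ G.L a, x.length = y + 1} (unaryMoves σ' ⟨a, hf⟩) := by
      intro n hn
      have := hdom (List.replicate n a) (by rwa [hlink, List.length_replicate, unaryMoves_of_length])
      rwa [hlink, List.length_replicate] at this
    apply hne
    ext w
    rw [hlink, hlink, unaryMoves_of_length, hm _ hsub']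
  · refine ⟨fun _ _ => Move.read, ?_⟩
    rintro ⟨σ', -, hne⟩
    apply hne
    have hno : ∀ b : G.FunSym, False := fun b => hf (Subsingleton.elim b.1 a ▸ b.2)
    rw [show (fun _ _ => Move.read : G.Strategy) = σ' from funext fun _ => funext fun b =>
      (hno b).elim]

end Game

/-! ### Optimal policies for word-indexed runs -/

section Policy

variable {X : Type*} {A : Type*}

/-- The languages that are accepted by a run from `x`: a run labels the words with elements of `X`
such that the label of `u ++ [a]` is an option for `a` at the label of `u`. -/
def runLanguages (opt : X → A → X → Prop) (acc : X → Prop) (x : X) : Set (Set (List A)) :=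
  {V | ∃ R : List A → X, R [] = x ∧ (∀ u a, opt (R u) a (R (u ++ [a]))) ∧ V = {u | acc (R u)}}

theorem FirstDiffLE.of_cons [LinearOrder A] [Finite A] {V W : Set (List A)}
    (hnil : [] ∈ V → [] ∈ W)
    (hcons : ∀ a, FirstDiffLE shortlexRank {v | a :: v ∈ V} {v | a :: v ∈ W}) :
    FirstDiffLE shortlexRank V W := by
  intro w hw hlt
  cases w with
  | nil => exact hnil hw
  | cons a v =>
    refine hcons a v hw fun x hx => hlt (a :: x) ?_
    rw [shortlexRank_lt_iff] at hx ⊢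
    exact List.Shortlex.cons hx

/-- With finitely many labels, the greatest language of a run is attained, as the limit of runs
that agree with it on longer and longer words. -/
theorem exists_greatest_runLanguage [LinearOrder A] [Finite A] [Finite X]
    {opt : X → A → X → Prop} (hopt : ∀ x a, ∃ y, opt x a y) (acc : X → Prop) (x : X) :
    ∃ M ∈ runLanguages opt acc x,
      ∀ V ∈ runLanguages opt acc x, FirstDiffLE shortlexRank V M := by
  choose c hc using hopt
  have hne : (runLanguages opt acc x).Nonempty :=
    ⟨_, fun u => u.foldl c x, rfl, fun u a => by simpa using hc _ _, rfl⟩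
  obtain ⟨M, hM, happrox⟩ := FirstDiffLE.exists_greedy shortlexRank_injective _ hne
  refine ⟨M, ?_, hM⟩
  choose V hV hVM using happrox
  choose r hr0 hr hrV using hV
  choose R hR using fun u => (Filter.hyperfilter ℕ).exists_eventually_eq fun n => r n u
  refine ⟨R, ?_, fun u a => ?_, ?_⟩
  · obtain ⟨n, hn⟩ := (hR []).exists
    rw [← hn, hr0]
  · obtain ⟨n, hn, hn'⟩ := ((hR u).and (hR (u ++ [a]))).exists
    rw [← hn, ← hn']
    exact hr n u a
  · ext u
    have hlarge : ∀ᶠ n in (Filter.hyperfilter ℕ : Filter ℕ), shortlexRank u < n := by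
      have := Filter.eventually_gt_atTop (α := ℕ) (shortlexRank u)
      rw [← Nat.cofinite_eq_atTop] at this
      exact Filter.hyperfilter_le_cofinite this
    obtain ⟨n, hn, hlt⟩ := ((hR u).and hlarge).exists
    rw [← hVM n u hlt, hrV, Set.mem_ofPred_eq, Set.mem_ofPred_eq, hn]

/-- There is a choice of options that does not depend on the word and is optimal from every label:
choose an option from which the greatest language of a run is as great as possible. -/
theorem exists_optimal_policy [LinearOrder A] [Finite A] [Finite X]
    {opt : X → A → X → Prop} (hopt : ∀ x a, ∃ y, opt x a y) (acc : X → Prop) :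
    ∃ c : X → A → X, (∀ x a, opt x a (c x a)) ∧
      ∀ x, ∀ V ∈ runLanguages opt acc x,
        FirstDiffLE shortlexRank V {u | acc (u.foldl c x)} := by
  choose M hM hmax using exists_greatest_runLanguage hopt acc
  have hbest : ∀ x a, ∃ y, opt x a y ∧
      ∀ z, opt x a z → FirstDiffLE shortlexRank (M z) (M y) := by
    intro x a
    have : Nonempty {y // opt x a y} := nonempty_subtype.2 (hopt x a)
    have : IsTrans {y // opt x a y} fun y z => FirstDiffLE shortlexRank (M y) (M z) :=
      ⟨fun _ _ _ => FirstDiffLE.trans⟩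
    have hdir : Directed (fun y z : {y // opt x a y} => FirstDiffLE shortlexRank (M y) (M z)) id :=
      fun y z => by
        rcases FirstDiffLE.total shortlexRank_injective (M y) (M z) with h | h
        · exact ⟨z, h, FirstDiffLE.refl _⟩
        · exact ⟨y, FirstDiffLE.refl _, h⟩
    obtain ⟨y, hy⟩ := hdir.finite_le id
    exact ⟨y, y.2, fun z hz => hy ⟨z, hz⟩⟩
  choose c hc hcmax using hbest
  -- The greatest language from `x` consists of the greatest languages from the chosen options.
  have hcons : ∀ x, M x = {u | match u with | [] => acc x | a :: v => v ∈ M (c x a)} := by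
    intro x
    refine FirstDiffLE.antisymm (FirstDiffLE.of_cons ?_ fun a => ?_) (hmax x _ ?_)
    · obtain ⟨R, rfl, -, h⟩ := hM x
      rw [h]
      exact id
    · obtain ⟨R, rfl, hR, h⟩ := hM x
      have := hmax (R [a]) _ ⟨fun u => R (a :: u), rfl, fun u b => hR (a :: u) b, rfl⟩
      rw [h]
      exact this.trans (hcmax _ _ _ (hR [] a))
    · choose R hR0 hR hRM using fun a => hM (c x a)
      refine ⟨fun u => match u with | [] => x | a :: v => R a v, rfl, ?_, ?_⟩
      · rintro (_ | ⟨b, u⟩) a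
        · simpa [hR0] using hc x a
        · exact hR b u a
      · ext (_ | ⟨a, v⟩)
        · rfl
        · simp only [Set.mem_ofPred_eq, hRM]
  refine ⟨c, hc, fun x V hV => ?_⟩
  have : {u | acc (u.foldl c x)} = M x := by
    clear hV
    ext u
    induction u generalizing x with
    | nil => rw [hcons]; rfl
    | cons a v ih =>
      rw [hcons]
      exact ih (c x a)
  rw [this]
  exact hmax x V hV

end Policy

namespace Game

variable {A : Type u} {Q : Type v} {G : Game A Q}

/-! ### Processing a symbol with bounded call depth -/

/-- `I` is an invariant of Juliet while a word of some residual language is processed: when `I p K`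
holds in state `p` with the rest of the word known to be in `K`, then `p ∈ S` if the word may be
finished, and `H` lets Juliet process any next symbol such that `I` holds again. -/
def Keeps (H : Q → A → Set Q → Prop) (S : Set Q) (I : Q → Language A → Prop) : Prop :=
  ∀ p K, I p K → ([] ∈ K → p ∈ S) ∧
    ∀ c, (∃ x, c :: x ∈ K) → H p c {p' | I p' (K.leftQuotient [c])}

/-- `G.Handle r p b S`: from state `p`, Juliet can process the symbol `b` with calls of nesting
depth at most `r` such that she is sure to arrive in `S`, when she decides on the basis of the
state and of the residual language of each reply that is being processed. -/
def Handle (G : Game A Q) : ℕ → Q → A → Set Q → Prop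
  | 0, p, b, S => G.T.step p b ∈ S
  | r + 1, p, b, S => G.T.step p b ∈ S ∨
      (G.IsFun b ∧ ∃ I, Keeps (Handle G r) S I ∧ I p (G.L b))

/-- Some invariant of Juliet holds in state `p` with the rest of the reply known to be in `K`. -/
def Sustain (G : Game A Q) (r : ℕ) (S : Set Q) (p : Q) (K : Language A) : Prop :=
  ∃ I, Keeps (G.Handle r) S I ∧ I p K

theorem Handle.of_step {r : ℕ} {p : Q} {b : A} {S : Set Q} (h : G.T.step p b ∈ S) :
    G.Handle r p b S := by
  cases r with
  | zero => exact h
  | succ r => exact Or.inl h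

theorem Handle.mono {r : ℕ} {p : Q} {b : A} {S S' : Set Q} (hS : S ⊆ S')
    (h : G.Handle r p b S) : G.Handle r p b S' := by
  cases r with
  | zero => exact hS h
  | succ r =>
    rcases h with h | ⟨hb, I, hI, hp⟩
    · exact Or.inl (hS h)
    · exact Or.inr ⟨hb, I, fun p K hK => ⟨fun hn => hS ((hI p K hK).1 hn), (hI p K hK).2⟩, hp⟩

theorem Handle.succ {r : ℕ} {p : Q} {b : A} {S : Set Q} (h : G.Handle r p b S) :
    G.Handle (r + 1) p b S := by
  induction r generalizing p b S with
  | zero => exact Or.inl h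
  | succ r ih =>
    rcases h with h | ⟨hb, I, hI, hp⟩
    · exact Or.inl h
    · exact Or.inr ⟨hb, I, fun p K hK => ⟨(hI p K hK).1, fun c hc => ih ((hI p K hK).2 c hc)⟩, hp⟩

theorem keeps_sustain (r : ℕ) (S : Set Q) : Keeps (G.Handle r) S (G.Sustain r S) := by
  rintro p K ⟨I, hI, hK⟩
  exact ⟨(hI p K hK).1, fun c hc => ((hI p K hK).2 c hc).mono fun p' hp' => ⟨I, hI, hp'⟩⟩

/-- Since there are finitely many states and symbols, some call depth suffices. -/
theorem exists_handle_depth (G : Game A Q) :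
    ∃ N, ∀ r p b S, G.Handle r p b S → G.Handle N p b S := by
  have := G.finite_alphabet
  have := G.finite_states
  let f : ℕ →o Set (Q × A × Set Q) :=
    ⟨fun r => {x | G.Handle r x.1 x.2.1 x.2.2}, monotone_nat_of_le_succ fun r x hx => Handle.succ hx⟩
  obtain ⟨N, hN⟩ := WellFoundedGT.monotone_chain_condition f
  refine ⟨N, fun r p b S h => ?_⟩
  have hmem : (p, b, S) ∈ f (max N r) := f.monotone (le_max_right N r) h
  rwa [← hN _ (le_max_left N r)] at hmem

/-! ### The winning sets are languages of runs -/

/-- `Proc σ α p w α' p'`: when `σ` continues from the history `α` with the target automaton in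
state `p` and with `w` as a prefix of the remaining string, then `α'` and `p'` are possible when
`w` has been processed. -/
inductive Proc (σ : G.Strategy) : List G.Hist → Q → List A → List G.Hist → Q → Prop
  | nil {α : List G.Hist} {p : Q} : Proc σ α p [] α p
  | read {α α' : List G.Hist} {p p' : Q} {a : A} {v : List A} : called σ α a = none →
      Proc σ (α ++ [Sum.inl a]) (G.T.step p a) v α' p' → Proc σ α p (a :: v) α' p'
  | call {α α' : List G.Hist} {p p' : Q} {a : A} {v : List A} {b : G.FunSym} {x : List A} :
      called σ α a = some b → x ∈ G.L b.1 →
      Proc σ (α ++ [Sum.inr b]) p (x ++ v) α' p' → Proc σ α p (a :: v) α' p'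

theorem Proc.ends {σ : G.Strategy} {S : Set Q} {α α' : List G.Hist} {p p' : Q} {u v : List A}
    (h : Proc σ α p u α' p') (he : Ends σ S α p (u ++ v)) : Ends σ S α' p' v := by
  induction h with
  | nil => exact he
  | read hc _ ih => exact ih ((Ends.read_iff hc).1 he)
  | call hc hx _ ih => exact ih (by simpa using (Ends.call_iff hc).1 he _ hx)

theorem Proc.append {σ : G.Strategy} {α α' α'' : List G.Hist} {p p' p'' : Q} {u v : List A}
    (h : Proc σ α p u α' p') (h' : Proc σ α' p' v α'' p'') : Proc σ α p (u ++ v) α'' p'' := by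
  induction h with
  | nil => exact h'
  | read hc _ ih => exact Proc.read hc (ih h')
  | call hc hx _ ih => exact Proc.call hc hx (by simpa using ih h')

/-- While a play that is sure to end processes a word, the states that may be reached after each
symbol can be enforced. For the replies to a call, the invariant consists of the pairs of a state
and a residual language that occur. -/
theorem Ends.handle {N : ℕ} (hN : ∀ r p b S, G.Handle r p b S → G.Handle N p b S)
    {σ : G.Strategy} {S : Set Q} {α α' : List G.Hist} {p p' : Q} {w u z : List A} {c : A}
    (h : Ends σ S α p w) (hw : w = u ++ c :: z) (hu : Proc σ α p u α' p') :
    G.Handle N p' c {p'' | ∃ α'', Proc σ α' p' [c] α'' p''} := by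
  induction h generalizing α' p' u z c with
  | nil => simp at hw
  | @read α p a v hc _ ih =>
    cases u with
    | nil =>
      cases hu
      obtain ⟨rfl, rfl⟩ := List.cons.inj hw
      exact Handle.of_step ⟨_, Proc.read hc Proc.nil⟩
    | cons a' u =>
      obtain ⟨rfl, rfl⟩ := List.cons.inj hw
      cases hu with
      | read _ hu => exact ih rfl hu
      | call hc' => rw [hc] at hc'; cases hc'
  | @call α p a v b hc _ ih =>
    cases u with
    | nil =>
      cases hu
      obtain ⟨rfl, rfl⟩ := List.cons.inj hw
      obtain ⟨rfl, -⟩ := called_eq_some.1 hc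
      refine hN (N + 1) _ _ _ (Or.inr ⟨b.2, fun p' K => ∃ α' x,
        Proc σ (α ++ [Sum.inr b]) p x α' p' ∧ K = (G.L b.1).leftQuotient x, ?_, _, [], Proc.nil,
        (Language.leftQuotient_nil _).symm⟩)
      rintro p' _ ⟨α', x, hx, rfl⟩
      refine ⟨fun hn => ?_, fun c => ?_⟩
      · rw [Language.mem_leftQuotient, List.append_nil] at hn
        exact ⟨α', Proc.call hc hn (by simpa using hx)⟩
      · rintro ⟨y, hy⟩
        rw [Language.mem_leftQuotient] at hy
        refine (ih _ hy (z := y ++ v) (by simp) hx).mono ?_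
        rintro p'' ⟨α'', h''⟩
        exact ⟨α'', x ++ [c], hx.append h'', (Language.leftQuotient_append _ _ _).symm⟩
    | cons a' u =>
      obtain ⟨rfl, rfl⟩ := List.cons.inj hw
      cases hu with
      | read hc' => rw [hc] at hc'; cases hc'
      | call hc' hx hu =>
        rw [hc] at hc'
        cases hc'
        exact ih _ hx (z := z) (by simp) hu

/-- The sets of states that may be reached after the prefixes of the words of a winning set form a
run. Where no continuation is in the winning set, nothing is required of the run. -/
theorem exists_run_of_strategy {N : ℕ} (hN : ∀ r p b S, G.Handle r p b S → G.Handle N p b S)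
    (σ : G.Strategy) (hne : ∃ w, w ∈ W σ) :
    ∃ V ∈ runLanguages (fun P a P' => ∀ p ∈ P, G.Handle N p a P') (· ⊆ G.T.accept) {G.T.start},
      ∀ w ∈ W σ, w ∈ V := by
  classical
  let R : List A → Set Q := fun u =>
    if ∃ v, u ++ v ∈ W σ then {p | ∃ α, Proc σ [] G.T.start u α p} else Set.univ
  refine ⟨_, ⟨R, ?_, fun u a p hp => ?_, rfl⟩, fun w hw => ?_⟩
  · simp only [R, List.nil_append, if_pos hne]
    ext p
    constructor
    · rintro ⟨α, h⟩
      cases h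
      rfl
    · rintro rfl
      exact ⟨[], Proc.nil⟩
  · by_cases hv : ∃ v, (u ++ [a]) ++ v ∈ W σ
    · simp only [R, if_pos hv]
      obtain ⟨v, hv⟩ := hv
      rw [List.append_assoc, List.singleton_append] at hv
      simp only [R, if_pos (show ∃ v, u ++ v ∈ W σ from ⟨_, hv⟩)] at hp
      obtain ⟨α, hα⟩ := hp
      refine ((mem_W_iff.1 hv).handle hN rfl hα).mono ?_
      rintro p' ⟨α', h'⟩
      exact ⟨α', hα.append h'⟩
    · simp only [R, if_neg hv]
      exact Handle.of_step trivial
  · simp only [Set.mem_ofPred_eq, R, if_pos (show ∃ v, w ++ v ∈ W σ from ⟨[], by simpa using hw⟩)]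
    rintro p ⟨α, hα⟩
    exact Ends.nil_iff.1 (hα.ends (by simpa using mem_W_iff.1 hw))

/-! ### Strategies with finite memory -/

/-- A strategy that decides on the basis of a finite memory is regular, by the Myhill–Nerode
theorem. -/
theorem regular_of_finite_memory {M : Type*} (upd : M → G.Hist → M) (m₀ : M)
    (dec : M → G.FunSym → Move) (hfin : (Set.range fun α : List G.Hist => α.foldl upd m₀).Finite) :
    Regular fun α a => dec (α.foldl upd m₀) a := by
  refine Language.IsRegular.of_finite_range_leftQuotient ?_
  let g : M × Prop → Language G.Hist := fun x =>
    {y | (y = [] ∧ x.2) ∨ ∃ β a, dec (β.foldl upd x.1) a = Move.call ∧ y = β ++ [Sum.inl a.1]}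
  refine ((hfin.prod (Set.finite_univ (α := Prop))).image g).subset ?_
  rintro _ ⟨x, rfl⟩
  refine ⟨(x.foldl upd m₀, ∃ (α : List G.Hist) (a : G.FunSym), dec (α.foldl upd m₀) a = Move.call ∧
    x = α ++ [Sum.inl a.1]), ⟨⟨x, rfl⟩, trivial⟩, ?_⟩
  ext y
  change y ∈ g _ ↔ ∃ (α : List G.Hist) (a : G.FunSym), dec (α.foldl upd m₀) a = Move.call ∧
    x ++ y = α ++ [Sum.inl a.1]
  constructor
  · rintro (⟨rfl, h⟩ | ⟨β, a, h, rfl⟩)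
    · rw [List.append_nil]
      exact h
    · exact ⟨x ++ β, a, by simpa using h, by simp⟩
  · rintro ⟨α, a, h, hx⟩
    rcases List.eq_nil_or_concat y with rfl | ⟨β, s, rfl⟩
    · exact Or.inl ⟨rfl, α, a, h, by simpa using hx⟩
    · rw [List.concat_eq_append, ← List.append_assoc] at hx
      obtain ⟨rfl, hs⟩ := List.append_inj' hx rfl
      obtain rfl := (List.cons.inj hs).1
      exact Or.inr ⟨β, a, by simpa using h, by simp⟩

/-- The memory of the strategy for prefix-free games: the state of the target automaton, the label
in the run of the part of the input word that has been begun, and, for each call whose reply is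
being processed, innermost first, the set of states in which it has to end and the residual
language of the reply. -/
structure Memory (A : Type u) (Q : Type v) where
  state : Q
  label : Set Q
  frames : List (Set Q × Language A)

namespace Memory

open Classical in
/-- Remove the innermost calls as long as their replies have ended. In a prefix-free game, a reply
has ended as soon as its residual language contains the empty word. -/
noncomputable def trim (l : List (Set Q × Language A)) : List (Set Q × Language A) :=
  l.dropWhile fun f => [] ∈ f.2

/-- The frames after the current symbol `a`. -/
def advance (a : A) : List (Set Q × Language A) → List (Set Q × Language A)
  | [] => []
  | (S, K) :: l => (S, K.leftQuotient [a]) :: l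

theorem length_advance (a : A) (l : List (Set Q × Language A)) :
    (advance a l).length = l.length := by
  cases l <;> rfl

variable (G) (N : ℕ) (c : Set Q → A → Set Q)

/-- The label after the current symbol `a`. -/
def nextLabel (m : Memory A Q) (a : A) : Set Q :=
  if m.frames = [] then c m.label a else m.label

/-- The set of states in which Juliet wants to arrive after the current symbol `a`. -/
def goal (m : Memory A Q) (a : A) : Set Q :=
  match m.frames with
  | [] => c m.label a
  | (S, K) :: l => {p | G.Sustain (N - (l.length + 1)) S p (K.leftQuotient [a])}

open Classical in
/-- The memory after a move. -/
noncomputable def update (m : Memory A Q) : G.Hist → Memory A Q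
  | Sum.inl a => ⟨G.T.step m.state a, nextLabel c m a, trim (advance a m.frames)⟩
  | Sum.inr b => ⟨m.state, nextLabel c m b.1,
      if m.frames.length < N then (goal G N c m b.1, G.L b.1) :: advance b.1 m.frames
      else advance b.1 m.frames⟩

open Classical in
/-- Juliet reads the current symbol if that takes her to her goal. -/
noncomputable def decision (m : Memory A Q) (a : G.FunSym) : Move :=
  if G.T.step m.state a.1 ∈ goal G N c m a.1 then Move.read else Move.call

end Memory

section MemoryStrategy

open Memory

variable (G) (N : ℕ) (c : Set Q → A → Set Q)

/-- The memory after a history. -/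
noncomputable def memory (α : List G.Hist) : Memory A Q :=
  α.foldl (update G N c) ⟨G.T.start, {G.T.start}, []⟩

/-- Juliet follows the policy `c` on the input word, and in each reply she keeps an invariant which
ensures that the call ends where it has to. -/
noncomputable def memoryStrategy : G.Strategy := fun α a => decision G N c (memory G N c α) a

variable {G N c}

theorem memory_append (α : List G.Hist) (h : G.Hist) :
    memory G N c (α ++ [h]) = update G N c (memory G N c α) h := by
  simp [memory]

theorem memoryStrategy_eq_read {α : List G.Hist} {m : Memory A Q} (hm : memory G N c α = m)
    {b : G.FunSym} :
    memoryStrategy G N c α b = Move.read ↔ G.T.step m.state b.1 ∈ goal G N c m b.1 := by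
  subst hm
  simp only [memoryStrategy, decision]
  split_ifs with h <;> simp [h]

theorem nil_notMem_L (a : A) : [] ∉ G.L a := fun h => G.ne_nil _ _ h rfl

/-- The strategy takes Juliet to her goal when a symbol is processed. The induction is on the number
`d` of calls that may still be nested at the current symbol. -/
theorem ends_memoryStrategy_cons (hG : G.PrefixFree) (d : ℕ) {F : Set Q} {α : List G.Hist}
    {m : Memory A Q} {a : A} {v : List A} (hm : memory G N c α = m)
    (hd : d + m.frames.length = N) (hh : G.Handle d m.state a (goal G N c m a))
    (hend : ∀ α' q, memory G N c α' = ⟨q, nextLabel c m a, trim (advance a m.frames)⟩ →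
      q ∈ goal G N c m a → Ends (memoryStrategy G N c) F α' q v) :
    Ends (memoryStrategy G N c) F α m.state (a :: v) := by
  induction d generalizing α m a v with
  | zero =>
    have hca : called (memoryStrategy G N c) α a = none := 
      called_eq_none.2 fun _ => (memoryStrategy_eq_read hm).2 hh
    exact Ends.read hca (hend _ _ (by rw [memory_append, hm]; rfl) hh)
  | succ d ih =>
    rcases hca : called (memoryStrategy G N c) α a with _ | b
    · have hstep : G.T.step m.state a ∈ goal G N c m a := by
        rcases hh with hh | ⟨ha, -⟩
        · exact hh
        · exact (memoryStrategy_eq_read hm).1 (called_eq_none.1 hca ha)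
      exact Ends.read hca (hend _ _ (by rw [memory_append, hm]; rfl) hstep)
    · refine Ends.call hca ?_
      obtain ⟨rfl, hb⟩ := called_eq_some.1 hca
      obtain ⟨I, hI, hIL⟩ : ∃ I, Keeps (G.Handle d) (goal G N c m b.1) I ∧ I m.state (G.L b.1) := by
        rcases hh with hh | ⟨-, hI⟩
        · rw [(memoryStrategy_eq_read hm).2 hh] at hb
          cases hb
        · exact hI
      -- The reply is processed symbol by symbol, with its residual language `K` in the frame.
      have key : ∀ (x : List A) (K : Language A) (α' : List G.Hist) (q : Q),
          memory G N c α' = ⟨q, nextLabel c m b.1,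
            trim ((goal G N c m b.1, K) :: advance b.1 m.frames)⟩ →
          x ∈ K → (∀ y z, y ∈ K → z ∈ K → y <+: z → y = z) →
          G.Sustain d (goal G N c m b.1) q K → Ends (memoryStrategy G N c) F α' q (x ++ v) := by
        intro x
        induction x with
        | nil =>
          intro K α' q hα' hx _ hs
          refine hend α' q ?_ ((keeps_sustain d _ q K hs).1 hx)
          rw [hα']
          simp [trim, hx]
        | cons e x ihx =>
          intro K α' q hα' hx hK hs
          have hnil : [] ∉ K := fun hn => by cases hK _ _ hn hx List.nil_prefix
          have htrim : trim ((goal G N c m b.1, K) :: advance b.1 m.frames) =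
              (goal G N c m b.1, K) :: advance b.1 m.frames := by simp [trim, hnil]
          rw [htrim] at hα'
          have hlen := length_advance b.1 m.frames
          have hN : N - ((advance b.1 m.frames).length + 1) = d := by omega
          refine ih hα' (by simp only [List.length_cons]; omega) ?_ ?_
          · simp only [goal, hN]
            exact (keeps_sustain d _ q K hs).2 e ⟨x, hx⟩
          · intro α'' q' hα'' hq'
            simp only [goal, hN] at hq'
            refine ihx (K.leftQuotient [e]) α'' q' hα'' hx (fun y z hy hz hyz => ?_) hq'
            exact List.cons_injective (hK _ _ hy hz (List.cons_prefix_cons.2 ⟨rfl, hyz⟩))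
      intro x hx
      refine key x (G.L b.1) _ _ ?_ hx (fun y z => hG b.1 y z) ⟨I, hI, hIL⟩
      have hlt : m.frames.length < N := by omega
      simp only [memory_append, hm, update, if_pos hlt]
      simp [trim, nil_notMem_L]

/-- On the input word, Juliet always arrives in the current label of the run. -/
theorem ends_memoryStrategy (hG : G.PrefixFree) (hc : ∀ P a, ∀ p ∈ P, G.Handle N p a (c P a))
    {F : Set Q} (w : List A) {α : List G.Hist} {q : Q} {P : Set Q}
    (hα : memory G N c α = ⟨q, P, []⟩) (hq : q ∈ P) (hP : w.foldl c P ⊆ F) :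
    Ends (memoryStrategy G N c) F α q w := by
  induction w generalizing α q P with
  | nil => exact Ends.nil (hP hq)
  | cons a v ih =>
    refine ends_memoryStrategy_cons hG N hα (by simp) (hc P a q hq) fun α' q' hα' hq' => ?_
    exact ih hα' hq' hP

theorem regular_memoryStrategy : Regular (memoryStrategy G N c) := by
  have := G.finite_alphabet
  have := G.finite_states
  refine regular_of_finite_memory (update G N c) _ (decision G N c) ?_
  let K : Set (Language A) := ⋃ a, Set.range (G.L a).leftQuotient
  have hK : K.Finite := Set.finite_iUnion fun a => (G.regular a).finite_range_leftQuotient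
  have : Finite K := hK
  let l : Set (List (Set Q × Language A)) := {l | l.length ≤ N ∧ ∀ f ∈ l, f.2 ∈ K}
  have hl : l.Finite := by
    refine ((List.finite_length_le (Set Q × K) N).image
      (List.map fun f => (f.1, f.2.1))).subset ?_
    rintro l ⟨hlN, hlK⟩
    refine ⟨l.attach.map fun f => (f.1.1, ⟨f.1.2, hlK _ f.2⟩), by simpa using hlN, ?_⟩
    rw [List.map_map]
    exact List.attach_map_subtype_val l
  have hadv : ∀ a, ∀ x ∈ l, advance a x ∈ l := by
    rintro a (_ | ⟨⟨S, K'⟩, x⟩) ⟨hN, hx⟩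
    · exact ⟨hN, hx⟩
    · refine ⟨hN, fun f hf => ?_⟩
      rcases List.mem_cons.1 hf with rfl | hf
      · obtain ⟨b, u, hu⟩ := Set.mem_iUnion.1 (hx _ List.mem_cons_self)
        refine Set.mem_iUnion.2 ⟨b, u ++ [a], ?_⟩
        rw [Language.leftQuotient_append, hu]
      · exact hx f (List.mem_cons_of_mem _ hf)
  have htrim : ∀ x ∈ l, trim x ∈ l := fun x hx =>
    ⟨(List.length_dropWhile_le _ _).trans hx.1,
      fun f hf => hx.2 f ((List.dropWhile_sublist _).subset hf)⟩
  refine (((Set.finite_univ (α := Q × Set Q)).prod hl).image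
    fun x => (⟨x.1.1, x.1.2, x.2⟩ : Memory A Q)).subset ?_
  rintro _ ⟨α, rfl⟩
  suffices h : (memory G N c α).frames ∈ l from
    ⟨(((memory G N c α).state, (memory G N c α).label), (memory G N c α).frames),
      ⟨trivial, h⟩, rfl⟩
  induction α using List.reverseRecOn with
  | nil => exact ⟨Nat.zero_le _, fun f hf => by cases hf⟩
  | append_singleton α s ih =>
    rw [memory_append]
    cases s with
    | inl a => exact htrim _ (hadv a _ ih)
    | inr b =>
      simp only [update]
      split_ifs with hlt
      · have := hadv b.1 _ ih
        have hlen := length_advance b.1 (memory G N c α).frames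
        refine ⟨by simp only [List.length_cons]; omega, fun f hf => ?_⟩
        rcases List.mem_cons.1 hf with rfl | hf
        · exact Set.mem_iUnion.2 ⟨b.1, [], rfl⟩
        · exact this.2 f hf
      · exact hadv b.1 _ ih

end MemoryStrategy

/-- No winning set is greater than the language of the optimal run, on which the strategy with
finite memory wins. -/
theorem exists_regular_weaklyDominant_of_prefixFree [LinearOrder A] (hG : G.PrefixFree) :
    ∃ σ : G.Strategy, Regular σ ∧ WeaklyDominant σ := by
  have := G.finite_alphabet
  have := G.finite_states
  obtain ⟨N, hN⟩ := G.exists_handle_depth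
  obtain ⟨c, hc, hopt⟩ := exists_optimal_policy
    (opt := fun P a P' => ∀ p ∈ P, G.Handle N p a P')
    (fun P a => ⟨Set.univ, fun p _ => Handle.of_step trivial⟩) (· ⊆ G.T.accept)
  refine ⟨memoryStrategy G N c, regular_memoryStrategy,
    weaklyDominant_of_subset (V := {u | u.foldl c {G.T.start} ⊆ G.T.accept}) (fun σ => ?_)
      fun w hw => mem_W_iff.2 (ends_memoryStrategy hG hc w rfl rfl hw)⟩
  by_cases hne : ∃ w, w ∈ W σ
  · obtain ⟨V, hV, hsub⟩ := exists_run_of_strategy hN σ hne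
    exact (FirstDiffLE.of_subset hsub).trans (hopt _ V hV)
  · exact FirstDiffLE.of_subset fun w hw => absurd ⟨w, hw⟩ hne

end Game

theorem theorem1 {A : Type u} {Q : Type v} [LinearOrder A] (G : Game A Q) :
    (G.BoundedDepth → ∃ σ : G.Strategy, Game.WeaklyDominant σ) ∧
    (G.PrefixFree → ∃ σ : G.Strategy, Game.Regular σ ∧ Game.WeaklyDominant σ) ∧
    (G.FiniteTarget → (∃ σ : G.Strategy, Game.Dominant σ) →
      ∃ σ : G.Strategy, Game.StronglyRegular σ ∧ Game.Dominant σ) ∧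
    (G.NonRecursive → (∃ σ : G.Strategy, Game.Dominant σ) →
      ∃ σ : G.Strategy, Game.StronglyRegular σ ∧ Game.Dominant σ) ∧
    (G.Unary → ∃ σ : G.Strategy, Game.Undominated σ) :=
  ⟨Game.exists_weaklyDominant_of_boundedDepth, Game.exists_regular_weaklyDominant_of_prefixFree,
    fun h hd => ⟨G.eager, Game.positional_stronglyRegular _,
      Game.eager_dominant_of_finiteTarget h hd⟩,
    fun h hd => ⟨G.eager, Game.positional_stronglyRegular _,
      Game.eager_dominant_of_nonRecursive h hd⟩,
    Game.exists_undominated_of_unary⟩
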